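/- A hypergraph $G=(V,E)$ consists of a finite vertex set $V$ and a finite collection $E$ of non-empty subsets of $V$, called hyperedges; parallel hyperedges (repeated subsets) are allowed and count as different hyperedges. For $X\subseteq V$ let $d_G(X)$ be the number of hyperedges $e\in E$ with $e\cap X\neq\emptyset$ and $e\setminus X\neq\emptyset$, and for distinct $u,v\in V$ let $\lambda_G(u,v)=\min\{d_G(X): u\in X\subseteq V\setminus\{v\}\}$. For $T\subseteq V$, $G$ is Steiner $\ell$-hyperedge-connected (on $T$) if $\lambda_G(u,v)\ge \ell$ for every pair of distinct $u,v\in T$. An orientation of $G$ assigns to each hyperedge $e\in E$ a head $\mathrm{head}(e)\in e$; the vertices of $e\setminus\{\mathrm{head}(e)\}$ are the tails of the resulting hyperarc $(e,\mathrm{head}(e))$. A path from $t$ to $r$ in an orientation is an alternating sequence $t=v_1,a_1,v_2,\dots,a_{\ell-1},v_\ell=r$ of distinct vertices and distinct hyperarcs such that $v_i$ is a tail of $a_i$ and $v_{i+1}$ is the head of $a_i$ for every $1\le i\le \ell-1$. For $r\in T$, the orientation is Steiner rooted $k$-hyperarc-connected if for every $t\in T\setminus\{r\}$ there are $k$ pairwise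 hyperarc-disjoint paths from $t$ to $r$. **Theorem (Király–Lau).** Let $G=(V,E)$ be a hypergraph, $T\subseteq V$ a set of terminals, $r\in T$ a root vertex, and $k$ a positive integer. If $G$ is Steiner $2k$-hyperedge-connected, then $G$ has a Steiner rooted $k$-hyperarc-connected orientation. -/

import Mathlib

/-- A hypergraph with vertex type `V` whose hyperedges are labelled by `E`; `G.ends e` is the set of
vertices of the hyperedge `e`. Distinct labels may carry the same vertex set (parallel hyperedges);
a hypergraph whose hyperedges form a set of subsets of `V` is the case where `ends` is injective. -/
structure MultiHypergraph (V E : Type*) where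
  ends : E → Finset V

namespace MultiHypergraph

section Cuts

variable {V E : Type*} [DecidableEq V] [Fintype E]

/-- `δ_G(X)`: the hyperedges that meet both `X` and its complement. -/
def boundary (G : MultiHypergraph V E) (X : Finset V) : Finset E :=
  Finset.univ.filter fun e => (G.ends e ∩ X).Nonempty ∧ (G.ends e \ X).Nonempty

/-- The cut function `d_G(X) = |δ_G(X)|`. -/
def cutDegree (G : MultiHypergraph V E) (X : Finset V) : ℕ :=
  (G.boundary X).card

/-- `λ_G(u, v)`: the minimum of `d_G(X)` over all `X` with `u ∈ X ⊆ V \ {v}`, for `u ≠ v`. -/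
noncomputable def localConnectivity (G : MultiHypergraph V E) (u v : V) : ℕ :=
  sInf {d : ℕ | ∃ X : Finset V, u ∈ X ∧ v ∉ X ∧ G.cutDegree X = d}

/-- Steiner `k`-hyperedge-connectivity on the terminal set `T`. -/
def SteinerHyperedgeConnected (G : MultiHypergraph V E) (T : Finset V) (k : ℕ) : Prop :=
  ∀ u ∈ T, ∀ v ∈ T, u ≠ v → k ≤ G.localConnectivity u v

end Cuts

variable {V E : Type*}

/-- An orientation of `G`: every hyperedge gets one of its own vertices as its head. The hyperarc
`(e, head e)` is represented by the label `e`. -/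
structure Orientation (G : MultiHypergraph V E) where
  head : E → V
  head_mem : ∀ e, head e ∈ G.ends e

namespace Orientation

variable {G : MultiHypergraph V E}

/-- The tails of a hyperarc: all vertices of the hyperedge other than its head. -/
def tails [DecidableEq V] (D : G.Orientation) (e : E) : Finset V :=
  (G.ends e).erase (D.head e)

/-- A path `u = v₀, a₀, v₁, a₁, …, v_ℓ = v` of distinct vertices and distinct hyperarcs, where `v_i`
is a tail of `a_i` and `v_{i+1}` is the head of `a_i`. -/
structure DirectedPath [DecidableEq V] (D : G.Orientation) (u v : V) where
  length : ℕ
  vertex : Fin (length + 1) → V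
  arc : Fin length → E
  vertex_injective : Function.Injective vertex
  arc_injective : Function.Injective arc
  source_eq : vertex 0 = u
  target_eq : vertex (Fin.last length) = v
  tail_mem : ∀ i : Fin length, vertex i.castSucc ∈ D.tails (arc i)
  head_eq : ∀ i : Fin length, D.head (arc i) = vertex i.succ

/-- There are `k` pairwise hyperarc-disjoint directed paths from `u` to `v`. -/
def HasHyperarcDisjointPaths [DecidableEq V] (D : G.Orientation) (k : ℕ) (u v : V) : Prop :=
  ∃ P : Fin k → D.DirectedPath u v,
    Pairwise fun i j => Disjoint (Set.range (P i).arc) (Set.range (P j).arc)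

/-- Every terminal other than the root `r` has `k` hyperarc-disjoint paths to `r`. -/
def SteinerRootedHyperarcConnected [DecidableEq V] (D : G.Orientation) (T : Finset V) (r : V)
    (k : ℕ) : Prop :=
  ∀ t ∈ T, t ≠ r → D.HasHyperarcDisjointPaths k t r

end Orientation

end MultiHypergraph

/-! By Menger's theorem it suffices to choose heads so that every set containing a terminal but not
the root is left by at least `k` hyperarcs. A stronger statement carries the induction: the root has
degree exactly `2k`, a set `F` of `k` hyperedges leaving it is prescribed, and every set containing
the root but no other terminal must also be left by `k` hyperarcs (`IsRootedOrientation`). A new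
root joined to `r` by `2k` parallel edges brings any hypergraph into this form.

A non-terminal may be removed from a hyperedge as long as no relevant cut drops below `2k`, since
heads for the trimmed hypergraph also serve the original one. If the removal is blocked, there is a
tight set `X`, of degree exactly `2k`. Contract `X` to a terminal, orient, and adjust the
orientation so that exactly `k` hyperarcs leave `X` (`exists_outDegree_eq`). The other `k` boundary
hyperedges enter `X`; they are prescribed as leaving the root when the complement of `X` is
contracted to it. Submodularity of the out-degree glues the two orientations (`glue`).

If no hyperedge is left to trim, the hypergraph is starlike. Every non-terminal gets out-degree half
the number of its links, rounded down, and the in-degrees `m` of the terminals are taken maximal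
subject to leaving `k` outgoing hyperarcs at each relevant set. Tight sets then partition the
terminals other than the root. Summing their equalities and comparing with the cuts of their
majority extensions, in which each non-terminal joins the side holding most of its links, shows that
`m` has the right total. Hall's theorem turns `m` into heads (`exists_orientation_of_vector`). -/

namespace MultiHypergraph

/-! ### Out-degrees and rooted orientations -/

variable {V E : Type*} [DecidableEq V] [Fintype E]

/-- The hyperarcs leaving `X` when every hyperedge `e` gets the head `h e`. -/
def outArcs (G : MultiHypergraph V E) (h : E → V) (X : Finset V) : Finset E :=
  Finset.univ.filter fun e => (G.ends e ∩ X).Nonempty ∧ h e ∉ X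

/-- The number of hyperarcs leaving `X`. -/
def outDegree (G : MultiHypergraph V E) (h : E → V) (X : Finset V) : ℕ :=
  (G.outArcs h X).card

lemma mem_boundary {G : MultiHypergraph V E} {X : Finset V} {e : E} :
    e ∈ G.boundary X ↔ (∃ v ∈ G.ends e, v ∈ X) ∧ ∃ v ∈ G.ends e, v ∉ X := by
  simp [boundary, Finset.Nonempty]

lemma mem_outArcs {G : MultiHypergraph V E} {h : E → V} {X : Finset V} {e : E} :
    e ∈ G.outArcs h X ↔ (∃ v ∈ G.ends e, v ∈ X) ∧ h e ∉ X := by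
  simp [outArcs, Finset.Nonempty]

lemma boundary_compl [Fintype V] (G : MultiHypergraph V E) (X : Finset V) :
    G.boundary Xᶜ = G.boundary X := by
  ext e
  simp only [mem_boundary, Finset.mem_compl, not_not]
  tauto

/-- Submodularity is checked hyperarc by hyperarc. The restriction to `A` serves the Menger
argument, where used hyperarcs are deleted. -/
lemma card_outArcs_inter_submodular [DecidableEq E] (G : MultiHypergraph V E) (h : E → V)
    (A : Finset E) (P Q : Finset V) :
    (G.outArcs h (P ∩ Q) ∩ A).card + (G.outArcs h (P ∪ Q) ∩ A).card ≤
      (G.outArcs h P ∩ A).card + (G.outArcs h Q ∩ A).card := by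
  rw [← Finset.card_union_add_card_inter (G.outArcs h (P ∩ Q) ∩ A),
    ← Finset.card_union_add_card_inter (G.outArcs h P ∩ A),
    ← Finset.union_inter_distrib_right, ← Finset.union_inter_distrib_right,
    ← Finset.inter_inter_distrib_right, ← Finset.inter_inter_distrib_right]
  apply add_le_add <;> apply Finset.card_le_card <;> apply Finset.inter_subset_inter_right <;>
    intro e <;> simp only [Finset.mem_union, Finset.mem_inter, mem_outArcs]
  · rintro (⟨⟨v, hv, hP, hQ⟩, h1⟩ | ⟨⟨v, hv, hP | hQ⟩, h1⟩)
    · by_cases hh : h e ∈ P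
      · exact Or.inr ⟨⟨v, hv, hQ⟩, fun h2 => h1 ⟨hh, h2⟩⟩
      · exact Or.inl ⟨⟨v, hv, hP⟩, hh⟩
    · exact Or.inl ⟨⟨v, hv, hP⟩, fun h2 => h1 (Or.inl h2)⟩
    · exact Or.inr ⟨⟨v, hv, hQ⟩, fun h2 => h1 (Or.inr h2)⟩
  · rintro ⟨⟨⟨v, hv, hP, hQ⟩, -⟩, -, h2⟩
    exact ⟨⟨⟨v, hv, hP⟩, fun h3 => h2 (Or.inl h3)⟩, ⟨v, hv, hQ⟩, fun h3 => h2 (Or.inr h3)⟩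

lemma outDegree_submodular (G : MultiHypergraph V E) (h : E → V) (P Q : Finset V) :
    G.outDegree h (P ∩ Q) + G.outDegree h (P ∪ Q) ≤ G.outDegree h P + G.outDegree h Q := by
  classical
  simpa [outDegree] using G.card_outArcs_inter_submodular h Finset.univ P Q

/-- A Steiner `2k`-hyperedge-connected hypergraph with a root of degree exactly `2k`, together with
a choice `F` of `k` hyperedges at the root that have to leave it. -/
structure IsRootedInstance (G : MultiHypergraph V E) (T : Finset V) (r : V) (k : ℕ)
    (F : Finset E) : Prop where
  root_mem : r ∈ T
  exists_terminal : ∃ t ∈ T, t ≠ r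
  nonempty : ∀ e, (G.ends e).Nonempty
  cut : ∀ X : Finset V, r ∉ X → (∃ t ∈ T, t ∈ X) → 2 * k ≤ G.cutDegree X
  root_degree : G.cutDegree {r} = 2 * k
  subset : F ⊆ G.boundary {r}
  card : F.card = k

/-- Head assignments in which exactly the hyperedges of `F` leave the root, every terminal is
`k`-connected to the root, and the root is `k`-connected to the set of the other terminals. -/
structure IsRootedOrientation (G : MultiHypergraph V E) (T : Finset V) (r : V) (k : ℕ)
    (F : Finset E) (h : E → V) : Prop where
  mem : ∀ e, h e ∈ G.ends e
  root_head : ∀ e, r ∈ G.ends e → (h e = r ↔ e ∉ F)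
  out : ∀ X : Finset V, r ∉ X → (∃ t ∈ T, t ∈ X) → k ≤ G.outDegree h X
  out_root : ∀ X : Finset V, r ∈ X → (∀ t ∈ T, t ∈ X → t = r) → k ≤ G.outDegree h X

/-- The hyperarcs entering the root are its boundary hyperedges outside `F`. Thus `{r}ᶜ` attains the
bound `k`, which starts the search for a minimal tight set below. -/
lemma IsRootedOrientation.outDegree_compl_root [Fintype V] {G : MultiHypergraph V E}
    {T : Finset V} {r : V} {k : ℕ} {F : Finset E} {h : E → V}
    (hG : G.IsRootedInstance T r k F) (hh : G.IsRootedOrientation T r k F h) :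
    G.outDegree h {r}ᶜ = k := by
  classical
  have : G.outArcs h {r}ᶜ = G.boundary {r} \ F := by
    ext e
    simp only [mem_outArcs, Finset.mem_sdiff, mem_boundary, Finset.mem_compl,
      Finset.mem_singleton, not_not]
    constructor
    · rintro ⟨h1, h2⟩
      have h3 : r ∈ G.ends e := h2 ▸ hh.mem e
      exact ⟨⟨⟨r, h3, rfl⟩, h1⟩, (hh.root_head e h3).1 h2⟩
    · rintro ⟨⟨⟨_, h3, rfl⟩, h1⟩, h2⟩
      exact ⟨h1, (hh.root_head e h3).2 h2⟩
  have h2 := hG.root_degree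
  unfold cutDegree at h2
  rw [outDegree, this, Finset.card_sdiff_of_subset hG.subset, hG.card, h2]
  omega

/-- The out-degree of a terminal other than the root can be lowered to exactly `k`. -/
lemma IsRootedOrientation.exists_outDegree_eq [Fintype V] {G : MultiHypergraph V E}
    {T : Finset V} {r : V} {k : ℕ} {F : Finset E} {x : V}
    (hG : G.IsRootedInstance T r k F) (hx : x ∈ T) (hxr : x ≠ r) (n : ℕ) :
    ∀ h : E → V, G.IsRootedOrientation T r k F h → G.outDegree h {x} = n →
      ∃ h', G.IsRootedOrientation T r k F h' ∧ G.outDegree h' {x} = k := by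
  classical
  induction n with
  | zero =>
    intro h hh hn
    have := hh.out {x} (by simpa using hxr.symm) ⟨x, hx, by simp⟩
    exact ⟨h, hh, by omega⟩
  | succ n ih =>
    intro h hh hn
    by_cases hk : n + 1 = k
    · exact ⟨h, hh, by omega⟩
    have hxk := hh.out {x} (by simpa using hxr.symm) ⟨x, hx, by simp⟩
    -- A minimal tight set around `x`. Since `{x}` is left by more hyperarcs than `Y`, some hyperarc
    -- `e` leaves `{x}` but has its head in `Y`.
    obtain ⟨Y, hY, hmin⟩ := Finset.exists_min_image
      (Finset.univ.filter fun Y : Finset V => x ∈ Y ∧ r ∉ Y ∧ G.outDegree h Y = k) Finset.card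
      ⟨{r}ᶜ, by simpa [hxr] using hh.outDegree_compl_root hG⟩
    simp only [Finset.mem_filter, Finset.mem_univ, true_and] at hY hmin
    obtain ⟨hxY, hrY, hYk⟩ := hY
    obtain ⟨e, he1, he2⟩ : ∃ e ∈ G.outArcs h {x}, e ∉ G.outArcs h Y := by
      by_contra! hcon
      have := Finset.card_le_card hcon
      unfold outDegree at *
      omega
    have hxe : x ∈ G.ends e := by
      obtain ⟨⟨v, hv, hvx⟩, -⟩ := mem_outArcs.1 he1
      rwa [Finset.mem_singleton.1 hvx] at hv
    have hzx : h e ≠ x := by simpa using (mem_outArcs.1 he1).2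
    have hzY : h e ∈ Y := by
      by_contra hcon
      exact he2 (mem_outArcs.2 ⟨⟨x, hxe, hxY⟩, hcon⟩)
    have hzr : h e ≠ r := fun h0 => hrY (h0 ▸ hzY)
    -- Turning `e` towards `x` lowers the out-degree only of sets that contain `x` but not the old
    -- head, and only by one.
    set h' : E → V := Function.update h e x with hh'
    have hne : ∀ f, f ≠ e → h' f = h f := fun f hf => by simp [hh', hf]
    have hee : h' e = x := by simp [hh']
    have hsub : ∀ X : Finset V, (x ∈ X → h e ∈ X) → G.outDegree h X ≤ G.outDegree h' X := by
      intro X hX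
      apply Finset.card_le_card
      intro f hf
      rw [mem_outArcs] at hf ⊢
      refine ⟨hf.1, ?_⟩
      by_cases hfe : f = e
      · subst hfe
        rw [hee]
        exact fun h0 => hf.2 (hX h0)
      · rw [hne f hfe]
        exact hf.2
    have herase : ∀ X : Finset V, G.outDegree h X ≤ G.outDegree h' X + 1 := by
      intro X
      refine (Finset.card_le_card (t := insert e (G.outArcs h' X)) ?_).trans
        (Finset.card_insert_le _ _)
      intro f hf
      by_cases hfe : f = e
      · simp [hfe]
      · rw [Finset.mem_insert, mem_outArcs, hne f hfe]
        exact Or.inr (mem_outArcs.1 hf)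
    refine ih h' ⟨?_, ?_, ?_, ?_⟩ ?_
    · intro f
      by_cases hfe : f = e
      · subst hfe
        rwa [hee]
      · rw [hne f hfe]
        exact hh.mem f
    · intro f hf
      by_cases hfe : f = e
      · subst hfe
        rw [hee, ← hh.root_head f hf]
        exact iff_of_false hxr hzr
      · rw [hne f hfe]
        exact hh.root_head f hf
    · intro X hrX hTX
      by_cases hX : x ∈ X → h e ∈ X
      · exact (hh.out X hrX hTX).trans (hsub X hX)
      · push Not at hX
        have h1 := hh.out X hrX hTX
        by_contra hcon
        -- A set `X` that becomes deficient was tight. Uncrossing makes `X ∩ Y` tight, so minimality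
        -- gives `Y ⊆ X`, although `h e` lies in `Y` and not in `X`.
        have h2 := herase X
        have h3 : G.outDegree h X = k := by omega
        have h4 := G.outDegree_submodular h X Y
        have h5 := hh.out (X ∩ Y) (by simp [hrX]) ⟨x, hx, by simp [hX.1, hxY]⟩
        have h6 := hh.out (X ∪ Y) (by simp [hrX, hrY]) ⟨x, hx, by simp [hX.1]⟩
        have h7 := hmin (X ∩ Y) ⟨by simp [hX.1, hxY], by simp [hrX], by omega⟩
        have h8 := Finset.eq_of_subset_of_card_le Finset.inter_subset_right h7
        exact hX.2 (Finset.mem_inter.1 (h8.ge hzY)).1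
    · intro X hrX hTX
      exact (hh.out_root X hrX hTX).trans
        (hsub X fun hxX => absurd (hTX x hx hxX) hxr)
    · have : G.outArcs h' {x} = (G.outArcs h {x}).erase e := by
        ext f
        rw [Finset.mem_erase, mem_outArcs, mem_outArcs]
        by_cases hfe : f = e
        · subst hfe
          simp [hee]
        · simp [hne f hfe, hfe]
      rw [outDegree, this, Finset.card_erase_of_mem he1]
      unfold outDegree at hn
      omega

end MultiHypergraph

/-! ### Trimming, contraction and gluing along tight sets -/

namespace MultiHypergraph

variable {V E : Type*} [DecidableEq V] [Fintype E]

/-- The vertices that lie in some hyperedge. -/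
def support (G : MultiHypergraph V E) : Finset V :=
  Finset.univ.biUnion G.ends

/-- The number of vertices in the support plus the total size of the hyperedges. -/
def size (G : MultiHypergraph V E) : ℕ :=
  G.support.card + ∑ e, (G.ends e).card

/-- The hypergraph obtained by applying `c` to all vertices. -/
def map (G : MultiHypergraph V E) (c : V → V) : MultiHypergraph V E :=
  ⟨fun e => (G.ends e).image c⟩

/-- The hypergraph obtained by removing the vertex `v` from the hyperedge `e`. -/
def trim [DecidableEq E] (G : MultiHypergraph V E) (e : E) (v : V) : MultiHypergraph V E :=
  ⟨Function.update G.ends e ((G.ends e).erase v)⟩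

lemma mem_support {G : MultiHypergraph V E} {v : V} : v ∈ G.support ↔ ∃ e, v ∈ G.ends e := by
  simp [support]

lemma mem_ends_map {V E : Type*} [DecidableEq V] {G : MultiHypergraph V E} {c : V → V} {e : E} {w : V} :
    w ∈ (G.map c).ends e ↔ ∃ v ∈ G.ends e, c v = w := by
  simp [map]

lemma mem_ends_trim {V E : Type*} [DecidableEq V] [DecidableEq E] {G : MultiHypergraph V E} {e f : E} {v w : V} :
    w ∈ (G.trim e v).ends f ↔ w ∈ G.ends f ∧ (f = e → w ≠ v) := by
  by_cases hf : f = e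
  · subst hf
    simp [trim, and_comm]
  · simp [trim, hf]

lemma boundary_map [Fintype V] (G : MultiHypergraph V E) (c : V → V) (X : Finset V) :
    (G.map c).boundary X = G.boundary (Finset.univ.filter fun v => c v ∈ X) := by
  ext e
  simp [mem_boundary, mem_ends_map]

lemma size_map_lt {G : MultiHypergraph V E} {c : V → V} {a b : V} (ha : a ∈ G.support)
    (hb : b ∈ G.support) (hab : a ≠ b) (hc : c a = c b) : (G.map c).size < G.size := by
  apply add_lt_add_of_lt_of_le
  · have : (G.map c).support = G.support.image c := by
      ext w
      simp only [mem_support, mem_ends_map, Finset.mem_image]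
      grind
    rw [this]
    refine lt_of_le_of_ne Finset.card_image_le fun h => hab ?_
    exact Finset.card_image_iff.1 h ha hb hc
  · exact Finset.sum_le_sum fun e _ => Finset.card_image_le

lemma size_trim_lt [DecidableEq E] {G : MultiHypergraph V E} {e : E} {v : V}
    (hv : v ∈ G.ends e) : (G.trim e v).size < G.size := by
  apply add_lt_add_of_le_of_lt
  · apply Finset.card_le_card
    intro w
    simp only [mem_support, mem_ends_trim]
    rintro ⟨f, hf, -⟩
    exact ⟨f, hf⟩
  · apply Finset.sum_lt_sum
    · intro f _
      exact Finset.card_le_card fun w hw => (mem_ends_trim.1 hw).1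
    · refine ⟨e, Finset.mem_univ _, Finset.card_lt_card ⟨fun w hw => (mem_ends_trim.1 hw).1, ?_⟩⟩
      intro h
      exact (mem_ends_trim.1 (h hv)).2 rfl rfl

section Trim

variable [DecidableEq E] {G : MultiHypergraph V E} {T : Finset V} {r : V} {k : ℕ} {F : Finset E}
  {e : E} {v : V}

/-- By `he` the trimmed hyperedge keeps a vertex other than `r`, so the boundary of the root, and
with it `F`, survives. -/
lemma IsRootedInstance.trim (hG : G.IsRootedInstance T r k F) (hvT : v ∉ T)
    (he : ∀ t ∈ T, ¬ G.ends e ⊆ {v, t})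
    (hcut : ∀ X : Finset V, r ∉ X → (∃ t ∈ T, t ∈ X) → 2 * k ≤ (G.trim e v).cutDegree X) :
    (G.trim e v).IsRootedInstance T r k F := by
  have hvr : r ≠ v := fun h => hvT (h ▸ hG.root_mem)
  obtain ⟨w, hw, hwv⟩ := Finset.not_subset.1 (he r hG.root_mem)
  have hb : (G.trim e v).boundary {r} = G.boundary {r} := by
    ext f
    simp only [mem_boundary, mem_ends_trim, Finset.mem_singleton]
    constructor
    · rintro ⟨⟨a, ha, har⟩, b, hb, hbr⟩
      exact ⟨⟨a, ha.1, har⟩, b, hb.1, hbr⟩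
    · rintro ⟨⟨a, ha, har⟩, b, hb, hbr⟩
      refine ⟨⟨a, ⟨ha, fun _ => har ▸ hvr⟩, har⟩, ?_⟩
      by_cases hf : f = e
      · subst hf
        simp only [Finset.mem_insert, Finset.mem_singleton, not_or] at hwv
        exact ⟨w, ⟨hw, fun _ => hwv.1⟩, hwv.2⟩
      · exact ⟨b, ⟨hb, fun h => absurd h hf⟩, hbr⟩
  refine ⟨hG.root_mem, hG.exists_terminal, fun f => ?_, hcut, ?_, hb ▸ hG.subset, hG.card⟩
  · by_cases hf : f = e
    · subst hf
      simp only [Finset.mem_insert, Finset.mem_singleton, not_or] at hwv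
      exact ⟨w, mem_ends_trim.2 ⟨hw, fun _ => hwv.1⟩⟩
    · obtain ⟨a, ha⟩ := hG.nonempty f
      exact ⟨a, mem_ends_trim.2 ⟨ha, fun h => absurd h hf⟩⟩
  · rw [cutDegree, hb]
    exact hG.root_degree

lemma IsRootedOrientation.of_trim {h : E → V} (hvr : r ≠ v)
    (hh : (G.trim e v).IsRootedOrientation T r k F h) : G.IsRootedOrientation T r k F h := by
  have hout : ∀ X, (G.trim e v).outDegree h X ≤ G.outDegree h X := by
    intro X
    apply Finset.card_le_card
    intro f
    simp only [mem_outArcs, mem_ends_trim]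
    rintro ⟨⟨a, ha, haX⟩, h1⟩
    exact ⟨⟨a, ha.1, haX⟩, h1⟩
  exact ⟨fun f => (mem_ends_trim.1 (hh.mem f)).1,
    fun f hf => hh.root_head f (mem_ends_trim.2 ⟨hf, fun _ => hvr⟩),
    fun X h1 h2 => (hh.out X h1 h2).trans (hout X),
    fun X h1 h2 => (hh.out_root X h1 h2).trans (hout X)⟩

/-- Trimming can remove only `e` from a cut, so a cut that becomes deficient had exactly `2k`
hyperedges before. -/
lemma IsRootedInstance.exists_tight (hG : G.IsRootedInstance T r k F)
    (hcut : ¬ ∀ X : Finset V, r ∉ X → (∃ t ∈ T, t ∈ X) → 2 * k ≤ (G.trim e v).cutDegree X) :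
    ∃ X : Finset V, r ∉ X ∧ (∃ t ∈ T, t ∈ X) ∧ G.cutDegree X = 2 * k ∧
      e ∈ G.boundary X ∧ e ∉ (G.trim e v).boundary X := by
  push Not at hcut
  obtain ⟨X, hr, hT, hX⟩ := hcut
  have h1 := hG.cut X hr hT
  have hne : ∀ f, f ≠ e → (f ∈ (G.trim e v).boundary X ↔ f ∈ G.boundary X) := by
    intro f hf
    simp [mem_boundary, mem_ends_trim, hf]
  have h2 : e ∈ G.boundary X ∧ e ∉ (G.trim e v).boundary X := by
    by_contra hcon
    have : G.boundary X ⊆ (G.trim e v).boundary X := by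
      intro f hf
      by_cases hfe : f = e
      · subst hfe
        tauto
      · exact (hne f hfe).2 hf
    have := Finset.card_le_card this
    unfold cutDegree at *
    omega
  refine ⟨X, hr, hT, ?_, h2⟩
  have h3 : (G.boundary X).erase e ⊆ (G.trim e v).boundary X := by
    intro f hf
    rw [Finset.mem_erase] at hf
    exact (hne f hf.1).2 hf.2
  have := Finset.card_le_card h3
  rw [Finset.card_erase_of_mem h2.1] at this
  unfold cutDegree at *
  omega

end Trim

section Contraction

variable [Fintype V] {G : MultiHypergraph V E} {T : Finset V} {r : V} {k : ℕ} {F : Finset E}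

/-- Cuts of the contraction are cuts of `G` that do not split `X`, so the cut condition is
inherited; `t` stands for all terminals in `X`. -/
lemma IsRootedInstance.contract_inside (hG : G.IsRootedInstance T r k F) {X : Finset V} {t : V}
    (hr : r ∉ X) (htX : t ∈ X) (ht : t ∈ T) :
    (G.map fun v => if v ∈ X then t else v).IsRootedInstance
      (T.filter fun s => s ∈ X → s = t) r k F := by
  set c : V → V := fun v => if v ∈ X then t else v with hc
  have hcr : ∀ v, c v = r ↔ v = r := by
    intro v
    by_cases hv : v ∈ X
    · simp only [hc, hv, if_true]
      exact iff_of_false (fun h => hr (h ▸ htX)) (fun h => hr (h ▸ hv))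
    · simp [hc, hv]
  have hb : (G.map c).boundary {r} = G.boundary {r} := by
    rw [boundary_map]
    congr 1
    ext v
    simp [hcr]
  refine ⟨by simp [hG.root_mem, hr], ⟨t, by simp [ht], fun h => hr (h ▸ htX)⟩, ?_, ?_, ?_,
    hb ▸ hG.subset, hG.card⟩
  · intro e
    exact (hG.nonempty e).image c
  · rintro Y hrY ⟨s, hs, hsY⟩
    rw [Finset.mem_filter] at hs
    rw [cutDegree, boundary_map]
    refine hG.cut _ ?_ ⟨s, hs.1, ?_⟩
    · simpa [(hcr r).2 rfl] using hrY
    · have : c s = s := by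
        by_cases hsX : s ∈ X
        · simp [hc, hs.2 hsX]
        · simp [hc, hsX]
      simpa [this] using hsY
  · rw [cutDegree, hb]
    exact hG.root_degree

/-- Tightness of `X` gives the contracted root degree exactly `2k`. The set `F'` is left free so
that gluing can prescribe the hyperedges entering `X`. -/
lemma IsRootedInstance.contract_outside (hG : G.IsRootedInstance T r k F) {X : Finset V} {t : V}
    (hr : r ∉ X) (htX : t ∈ X) (ht : t ∈ T) (hX : G.cutDegree X = 2 * k) {F' : Finset E}
    (hF : F' ⊆ G.boundary X) (hF' : F'.card = k) :
    (G.map fun v => if v ∈ X then v else r).IsRootedInstance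
      (insert r (T ∩ X)) r k F' := by
  set c : V → V := fun v => if v ∈ X then v else r with hc
  have hb : (G.map c).boundary {r} = G.boundary X := by
    rw [boundary_map, ← boundary_compl]
    congr 1
    ext v
    simp only [Finset.mem_compl, Finset.mem_filter, Finset.mem_univ, true_and,
      Finset.mem_singleton, hc]
    split_ifs with h
    · simp only [h, iff_true]
      exact fun h0 => hr (h0 ▸ h)
    · simp [h]
  refine ⟨by simp, ⟨t, by simp [ht, htX], fun h => hr (h ▸ htX)⟩, ?_, ?_, ?_,
    hb ▸ hF, hF'⟩
  · intro e
    exact (hG.nonempty e).image c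
  · rintro Y hrY ⟨s, hs, hsY⟩
    rw [cutDegree, boundary_map]
    refine hG.cut _ ?_ ⟨s, ?_⟩
    · simpa [hc] using hrY
    · rw [Finset.mem_insert, Finset.mem_inter] at hs
      rcases hs with rfl | hs
      · exact absurd hsY hrY
      · exact ⟨hs.1, by simpa [hc, hs.2] using hsY⟩
  · rw [cutDegree, hb]
    exact hX

/-- Gluing orientations of the two contractions of a tight set. -/
lemma IsRootedOrientation.glue {X : Finset V} {t : V}
    (hr : r ∉ X) (htX : t ∈ X) (ht : t ∈ T) {F' : Finset E} {h₁ h₂ : E → V}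
    (hh₁ : (G.map fun v => if v ∈ X then t else v).IsRootedOrientation
      (T.filter fun s => s ∈ X → s = t) r k F h₁)
    (hk : (G.map fun v => if v ∈ X then t else v).outDegree h₁ {t} = k)
    (hF' : ∀ e, e ∈ F' ↔ e ∈ G.boundary X ∧ h₁ e = t) (hk' : F'.card = k)
    (hh₂ : (G.map fun v => if v ∈ X then v else r).IsRootedOrientation
      (insert r (T ∩ X)) r k F' h₂) :
    G.IsRootedOrientation T r k F fun e => if h₁ e = t then h₂ e else h₁ e := by
  set c₁ : V → V := fun v => if v ∈ X then t else v with hc₁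
  set c₂ : V → V := fun v => if v ∈ X then v else r with hc₂
  have c₁X : ∀ v ∈ X, c₁ v = t := fun v hv => by simp [hc₁, hv]
  have c₁nX : ∀ v, v ∉ X → c₁ v = v := fun v hv => by simp [hc₁, hv]
  have c₂X : ∀ v ∈ X, c₂ v = v := fun v hv => by simp [hc₂, hv]
  have c₂nX : ∀ v, v ∉ X → c₂ v = r := fun v hv => by simp [hc₂, hv]
  have htr : t ≠ r := fun h => hr (h ▸ htX)
  set h : E → V := fun e => if h₁ e = t then h₂ e else h₁ e with hh
  have heq₁ : ∀ e, h₁ e ≠ t → h e = h₁ e := fun e he => by simp [hh, he]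
  have heq₂ : ∀ e, h₁ e = t → h e = h₂ e := fun e he => by simp [hh, he]
  have hne : ∀ e, h₁ e ≠ t → h₁ e ∈ G.ends e ∧ h₁ e ∉ X := by
    intro e he
    obtain ⟨z, hz, hz'⟩ := mem_ends_map.1 (hh₁.mem e)
    by_cases hzX : z ∈ X
    · exact absurd (hz'.symm.trans (c₁X z hzX)) he
    · rw [c₁nX z hzX] at hz'
      exact hz' ▸ ⟨hz, hzX⟩
  have hmeet : ∀ e, h₁ e = t → ∃ v ∈ G.ends e, v ∈ X := by
    intro e he
    obtain ⟨z, hz, hz'⟩ := mem_ends_map.1 (hh₁.mem e)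
    refine ⟨z, hz, ?_⟩
    by_contra hzX
    rw [c₁nX z hzX, he] at hz'
    exact hzX (hz' ▸ htX)
  have hmem₂ : ∀ e, h₂ e ≠ r → h₂ e ∈ G.ends e ∧ h₂ e ∈ X := by
    intro e he
    obtain ⟨z, hz, hz'⟩ := mem_ends_map.1 (hh₂.mem e)
    by_cases hzX : z ∈ X
    · rw [c₂X z hzX] at hz'
      exact hz' ▸ ⟨hz, hzX⟩
    · exact absurd (hz'.symm.trans (c₂nX z hzX)) he
  have hsub : ∀ e, (∀ v ∈ G.ends e, v ∈ X) → h₂ e ≠ r := by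
    intro e he
    obtain ⟨z, hz, hz'⟩ := mem_ends_map.1 (hh₂.mem e)
    rw [← hz', c₂X z (he z hz)]
    exact fun h0 => hr (h0 ▸ he z hz)
  -- The two head maps agree on the boundary: the hyperedges entering `X` under `h₁` form `F'`, and
  -- these are prescribed to leave the contracted root under `h₂`.
  have heq : ∀ e, h₁ e = t → h₂ e ≠ r := by
    intro e he
    by_cases hX : ∀ v ∈ G.ends e, v ∈ X
    · exact hsub e hX
    · push Not at hX
      obtain ⟨v, hv, hvX⟩ := hX
      intro h0
      refine (hh₂.root_head e (mem_ends_map.2 ⟨v, hv, c₂nX v hvX⟩)).1 h0 ?_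
      exact (hF' e).2 ⟨mem_boundary.2 ⟨hmeet e he, v, hv, hvX⟩, he⟩
  have hhX : ∀ e, h e ∈ X ↔ h₁ e = t := by
    intro e
    by_cases he : h₁ e = t
    · simp only [he, iff_true]
      rw [heq₂ e he]
      exact (hmem₂ e (heq e he)).2
    · simp only [he, iff_false]
      rw [heq₁ e he]
      exact (hne e he).2
  have heq' : ∀ e, h₂ e ≠ r → h₁ e = t := by
    intro e he
    have h1 := hmem₂ e he
    by_contra hcon
    have h2 := (hne e hcon).1
    have h3 := (hne e hcon).2
    have h4 := (hh₂.root_head e (mem_ends_map.2 ⟨_, h2, c₂nX _ h3⟩)).not.1 he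
    exact hcon ((hF' e).1 (not_not.1 h4)).2
  have houtX : G.outDegree h X = k := by
    rw [← hk]
    unfold outDegree
    congr 1
    ext e
    simp only [mem_outArcs, hhX, mem_ends_map, Finset.mem_singleton]
    refine and_congr_left fun _ => ⟨?_, ?_⟩
    · rintro ⟨v, hv, hvX⟩
      exact ⟨t, ⟨v, hv, c₁X v hvX⟩, rfl⟩
    · rintro ⟨_, ⟨v, hv, hvt⟩, rfl⟩
      refine ⟨v, hv, ?_⟩
      by_contra hvX
      rw [c₁nX v hvX] at hvt
      exact hvX (hvt ▸ htX)
  have houtXc : G.outDegree h Xᶜ = k := by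
    rw [← hk']
    unfold outDegree
    congr 1
    ext e
    simp only [mem_outArcs, hF', mem_boundary, Finset.mem_compl, not_not, hhX]
    constructor
    · rintro ⟨h1, h2⟩
      exact ⟨⟨hmeet e h2, h1⟩, h2⟩
    · rintro ⟨⟨-, h1⟩, h2⟩
      exact ⟨h1, h2⟩
  have hdiff : ∀ Y : Finset V, (G.map c₁).outDegree h₁ (Y \ X) ≤ G.outDegree h (Y \ X) := by
    intro Y
    apply Finset.card_le_card
    intro e
    simp only [mem_outArcs, mem_ends_map, Finset.mem_sdiff]
    rintro ⟨⟨_, ⟨v, hv, rfl⟩, hvY, hvX⟩, h1⟩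
    have hv' : v ∉ X := fun h0 => hvX (by rwa [c₁X v h0])
    rw [c₁nX v hv'] at hvY
    refine ⟨⟨v, hv, hvY, hv'⟩, ?_⟩
    rintro ⟨h2, h3⟩
    have h4 := (hhX e).not.1 h3
    rw [heq₁ e h4] at h2 h3
    exact h1 ⟨h2, h3⟩
  have hunion : ∀ Y : Finset V, r ∉ Y → k ≤ G.outDegree h (Y ∪ X) := by
    intro Y hrY
    refine (hh₁.out (Y ∪ X) (by simp [hrY, hr]) ⟨t, by simp [ht], by simp [htX]⟩).trans ?_
    apply Finset.card_le_card
    intro e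
    simp only [mem_outArcs, mem_ends_map, Finset.mem_union]
    rintro ⟨⟨_, ⟨v, hv, rfl⟩, hvY⟩, h1⟩
    push Not at h1
    have h2 : h₁ e ≠ t := fun h0 => h1.2 (h0 ▸ htX)
    refine ⟨⟨v, hv, ?_⟩, ?_⟩
    · by_cases hvX : v ∈ X
      · exact Or.inr hvX
      · rwa [c₁nX v hvX] at hvY
    · rw [heq₁ e h2]
      tauto
  have hinter : ∀ Y : Finset V, r ∉ Y → (∃ s ∈ T, s ∈ Y ∧ s ∈ X) →
      k ≤ G.outDegree h (Y ∩ X) := by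
    rintro Y hrY ⟨s, hsT, hsY, hsX⟩
    refine (hh₂.out (Y ∩ X) (by simp [hrY]) ⟨s, by simp [hsT, hsX], by simp [hsY, hsX]⟩).trans ?_
    apply Finset.card_le_card
    intro e
    simp only [mem_outArcs, mem_ends_map, Finset.mem_inter]
    rintro ⟨⟨_, ⟨v, hv, rfl⟩, hvY, hvX⟩, h1⟩
    have hv' : v ∈ X := by
      by_contra h0
      rw [c₂nX v h0] at hvX
      exact hr hvX
    rw [c₂X v hv'] at hvY
    refine ⟨⟨v, hv, hvY, hv'⟩, ?_⟩
    rintro ⟨h2, h3⟩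
    rw [heq₂ e ((hhX e).1 h3)] at h2 h3
    exact h1 ⟨h2, h3⟩
  -- Here `out_root` is indispensable: in the second contraction `Y ∪ Xᶜ` becomes the root together
  -- with `Y ∩ X`, which contains no further terminal.
  have hcompl : ∀ Y : Finset V, (∀ s ∈ T, s ∈ Y → s ∉ X) → k ≤ G.outDegree h (Y ∪ Xᶜ) := by
    intro Y hY
    refine (hh₂.out_root (insert r (Y ∩ X)) (by simp) ?_).trans ?_
    · intro s hs hs'
      simp only [Finset.mem_insert, Finset.mem_inter] at hs hs'
      rcases hs with hs | hs
      · exact hs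
      · rcases hs' with hs' | hs'
        · exact hs'
        · exact absurd hs.2 (hY s hs.1 hs'.1)
    apply Finset.card_le_card
    intro e
    simp only [mem_outArcs, mem_ends_map, Finset.mem_insert, Finset.mem_inter, Finset.mem_union,
      Finset.mem_compl]
    rintro ⟨⟨_, ⟨v, hv, rfl⟩, hvY⟩, h1⟩
    push Not at h1
    have h2 := heq' e h1.1
    refine ⟨⟨v, hv, ?_⟩, ?_⟩
    · by_cases hvX : v ∈ X
      · rw [c₂X v hvX] at hvY
        rcases hvY with hvY | hvY
        · exact absurd (hvY ▸ hvX) hr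
        · exact Or.inl hvY.1
      · exact Or.inr hvX
    · have h3 := (hhX e).2 h2
      rw [heq₂ e h2] at h3 ⊢
      tauto
  -- If `Y` has no terminal in `X`, it is uncrossed with `Xᶜ` instead of `X`; both have out-degree
  -- exactly `k`.
  have hpos : ∀ Y : Finset V, (∀ s ∈ T, s ∈ Y → s ∉ X) →
      k ≤ (G.map c₁).outDegree h₁ (Y \ X) → k ≤ G.outDegree h Y := by
    intro Y hY h1
    have h2 := G.outDegree_submodular h Y Xᶜ
    rw [← Finset.sdiff_eq_inter_compl] at h2
    have h3 := hdiff Y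
    have h4 := hcompl Y hY
    omega
  refine ⟨?_, ?_, ?_, ?_⟩
  · intro e
    by_cases he : h₁ e = t
    · rw [heq₂ e he]
      exact (hmem₂ e (heq e he)).1
    · rw [heq₁ e he]
      exact (hne e he).1
  · intro e hre
    rw [← hh₁.root_head e (mem_ends_map.2 ⟨r, hre, c₁nX r hr⟩)]
    by_cases he : h₁ e = t
    · rw [heq₂ e he, he]
      exact iff_of_false (heq e he) htr
    · rw [heq₁ e he]
  · rintro Y hrY ⟨s, hs, hsY⟩
    by_cases hY : ∃ s ∈ T, s ∈ Y ∧ s ∈ X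
    · have h1 := G.outDegree_submodular h Y X
      have h2 := hunion Y hrY
      have h3 := hinter Y hrY hY
      omega
    · push Not at hY
      refine hpos Y hY (hh₁.out _ (by simp [hrY]) ⟨s, ?_, ?_⟩)
      · simp [hs, hY s hs hsY]
      · simp [hsY, hY s hs hsY]
  · intro Y hrY hTY
    refine hpos Y (fun s hs hsY => hTY s hs hsY ▸ hr) (hh₁.out_root _ (by simp [hrY, hr]) ?_)
    intro s hs hsY
    exact hTY s (Finset.mem_filter.1 hs).1 (Finset.mem_sdiff.1 hsY).1

end Contraction

end MultiHypergraph

/-! ### Integral vectors, Hall's theorem and a counting inequality -/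

/-- Integral vectors under an intersecting submodular bound, with prescribed entries outside `S`,
can be chosen such that `S` is partitioned by tight sets. -/
lemma exists_vector_tight_partition {V : Type*} [Fintype V] [DecidableEq V] (b : Finset V → ℤ)
    (R S : Finset V) (hS : S.Nonempty) (hSR : S ⊆ R) (m₀ : V → ℤ)
    (hb : ∀ X Y, X ⊆ R → Y ⊆ R → (∃ s ∈ S, s ∈ X ∧ s ∈ Y) → b (X ∩ Y) + b (X ∪ Y) ≤ b X + b Y) :
    ∃ m : V → ℤ, (∀ v, v ∉ S → m v = m₀ v) ∧
      (∀ X, X ⊆ R → (∃ s ∈ S, s ∈ X) → ∑ v ∈ X, m v ≤ b X) ∧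
      ∃ P : Finset (Finset V), (∀ X ∈ P, X ⊆ R ∧ (∃ s ∈ S, s ∈ X) ∧ ∑ v ∈ X, m v = b X) ∧
        (∀ X ∈ P, ∀ Y ∈ P, ∀ s ∈ S, s ∈ X → s ∈ Y → X = Y) ∧ ∀ s ∈ S, ∃ X ∈ P, s ∈ X := by
  -- Among the admissible vectors, one with maximal sum over `S` is taken; the constraint for `R`
  -- bounds this sum.
  obtain ⟨z, ⟨m, hm₀, hm, hz⟩, hmax⟩ := Int.exists_greatest_of_bdd
    (P := fun z => ∃ m : V → ℤ, (∀ v, v ∉ S → m v = m₀ v) ∧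
      (∀ X, X ⊆ R → (∃ s ∈ S, s ∈ X) → ∑ v ∈ X, m v ≤ b X) ∧ ∑ v ∈ S, m v = z) (by
      refine ⟨b R - ∑ v ∈ R \ S, m₀ v, ?_⟩
      rintro z ⟨m, hm₀, hm, rfl⟩
      obtain ⟨s, hs⟩ := hS
      have h1 := hm R subset_rfl ⟨s, hs, hSR hs⟩
      rw [← Finset.sum_sdiff hSR,
        Finset.sum_congr rfl fun v hv => hm₀ v (Finset.mem_sdiff.1 hv).2] at h1
      linarith) (by
      -- With this `M` a single entry `-M` outweighs all the prescribed entries and the bounds `b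
      -- X`, so the vector is admissible.
      set M : ℤ := ∑ X, |b X| + ∑ v, |m₀ v| with hM
      refine ⟨_, fun v => if v ∈ S then -M else m₀ v, fun v hv => by simp [hv], ?_, rfl⟩
      rintro X - ⟨s, hs, hsX⟩
      have hM0 : 0 ≤ M := by positivity
      have h1 : ∀ v ∈ X.erase s, (if v ∈ S then -M else m₀ v) ≤ |m₀ v| := by
        intro v _
        split_ifs
        · linarith [abs_nonneg (m₀ v)]
        · exact le_abs_self _
      rw [← Finset.add_sum_erase X _ hsX, if_pos hs]
      have h2 := Finset.sum_le_sum h1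
      have h3 : ∑ v ∈ X.erase s, |m₀ v| ≤ ∑ v, |m₀ v| :=
        Finset.sum_le_sum_of_subset_of_nonneg (Finset.subset_univ _) fun _ _ _ => abs_nonneg _
      have h4 : |b X| ≤ ∑ X, |b X| :=
        Finset.single_le_sum (f := fun X => |b X|) (fun _ _ => abs_nonneg _) (Finset.mem_univ X)
      linarith [neg_abs_le (b X)])
  -- If no set through `s` were tight, integrality would allow `m s` to be raised by one.
  have htight : ∀ s ∈ S, ∃ X, X ⊆ R ∧ s ∈ X ∧ ∑ v ∈ X, m v = b X := by
    intro s hs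
    by_contra! hcon
    have hupd : ∀ X : Finset V, ∑ v ∈ X, Function.update m s (m s + 1) v =
        ∑ v ∈ X, m v + if s ∈ X then 1 else 0 := by
      intro X
      split_ifs with hsX
      · rw [← Finset.add_sum_erase X _ hsX, ← Finset.add_sum_erase X m hsX,
          Function.update_self, Finset.sum_congr rfl fun v hv =>
            Function.update_of_ne (Finset.ne_of_mem_erase hv) _ _]
        ring
      · rw [add_zero]
        exact Finset.sum_congr rfl fun v hv =>
          Function.update_of_ne (by rintro rfl; exact hsX hv) _ _
    have h1 := hmax (∑ v ∈ S, Function.update m s (m s + 1) v)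
      ⟨Function.update m s (m s + 1), ?_, ?_, rfl⟩
    · rw [hupd, if_pos hs] at h1
      linarith
    · intro v hv
      rw [Function.update_of_ne (by rintro rfl; exact hv hs)]
      exact hm₀ v hv
    · intro X hXR hX
      rw [hupd]
      have h2 := hm X hXR hX
      split_ifs with hsX
      · have := hcon X hXR hsX
        omega
      · omega
  have hmaxl : ∀ s : V, ∃ X, s ∈ S → (X ⊆ R ∧ s ∈ X ∧ ∑ v ∈ X, m v = b X) ∧
      ∀ Y, Y ⊆ R → s ∈ Y → ∑ v ∈ Y, m v = b Y → Y.card ≤ X.card := by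
    intro s
    by_cases hs : s ∈ S
    · obtain ⟨X, hX⟩ := htight s hs
      obtain ⟨M, hM, hM'⟩ := Finset.exists_max_image (Finset.univ.filter fun X : Finset V =>
        X ⊆ R ∧ s ∈ X ∧ ∑ v ∈ X, m v = b X) Finset.card ⟨X, by simpa using hX⟩
      simp only [Finset.mem_filter, Finset.mem_univ, true_and] at hM hM'
      exact ⟨M, fun _ => ⟨hM, fun Y h1 h2 h3 => hM' Y ⟨h1, h2, h3⟩⟩⟩
    · exact ⟨∅, fun h => absurd h hs⟩
  choose M hM using hmaxl
  have hunion : ∀ X Y, X ⊆ R → Y ⊆ R → (∃ s ∈ S, s ∈ X ∧ s ∈ Y) → ∑ v ∈ X, m v = b X →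
      ∑ v ∈ Y, m v = b Y → ∑ v ∈ X ∪ Y, m v = b (X ∪ Y) := by
    rintro X Y hX hY ⟨s, hs, hsX, hsY⟩ h1 h2
    have h3 := hb X Y hX hY ⟨s, hs, hsX, hsY⟩
    have h4 := hm (X ∩ Y) (Finset.inter_subset_left.trans hX) ⟨s, hs, by simp [hsX, hsY]⟩
    have h5 := hm (X ∪ Y) (Finset.union_subset hX hY) ⟨s, hs, by simp [hsX]⟩
    have h6 := Finset.sum_union_inter (s₁ := X) (s₂ := Y) (f := m)
    linarith
  -- Tight sets sharing an element of `S` have a tight union, so those of maximal cardinality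
  -- coincide or are disjoint on `S`; outside `S` they may overlap.
  have hle : ∀ a ∈ S, ∀ c ∈ S, ∀ s ∈ S, s ∈ M a → s ∈ M c → M c ⊆ M a := by
    intro a ha c hc s hs hsa hsc
    obtain ⟨⟨ha1, ha2, ha3⟩, ha4⟩ := hM a ha
    obtain ⟨⟨hc1, hc2, hc3⟩, hc4⟩ := hM c hc
    have h1 := ha4 (M a ∪ M c) (Finset.union_subset ha1 hc1) (Finset.mem_union_left _ ha2)
      (hunion _ _ ha1 hc1 ⟨s, hs, hsa, hsc⟩ ha3 hc3)
    have h2 := Finset.eq_of_subset_of_card_le Finset.subset_union_left h1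
    rw [h2]
    exact Finset.subset_union_right
  refine ⟨m, hm₀, hm, S.image M, ?_, ?_, ?_⟩
  · intro X hX
    obtain ⟨s, hs, rfl⟩ := Finset.mem_image.1 hX
    exact ⟨(hM s hs).1.1, ⟨s, hs, (hM s hs).1.2.1⟩, (hM s hs).1.2.2⟩
  · intro X hX Y hY s hs hsX hsY
    obtain ⟨a, ha, rfl⟩ := Finset.mem_image.1 hX
    obtain ⟨c, hc, rfl⟩ := Finset.mem_image.1 hY
    exact (hle c hc a ha s hs hsY hsX).antisymm (hle a ha c hc s hs hsX hsY)
  · intro s hs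
    exact ⟨M s, Finset.mem_image_of_mem _ hs, (hM s hs).1.2.1⟩

/-- Hall's condition for choosing one vertex from each set `N e`, `e ∈ A`, such that every `v ∈ R`
is chosen `m v` times. -/
lemma exists_choice_with_multiplicities {V E : Type*} [DecidableEq V] [Nonempty V] (A : Finset E)
    (N : E → Finset V) (R : Finset V) (m : V → ℤ) (hsum : ∑ v ∈ R, m v = A.card)
    (hle : ∀ X ⊆ R, ∑ v ∈ X, m v ≤ (A.filter fun e => ∃ v ∈ N e, v ∈ X).card) :
    ∃ h : E → V, (∀ e ∈ A, h e ∈ N e ∧ h e ∈ R) ∧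
      ∀ v ∈ R, ((A.filter fun e => h e = v).card : ℤ) = m v := by
  classical
  -- The bound for `R.erase v` is at most the total, which leaves a nonnegative entry at `v`.
  have hnn : ∀ v ∈ R, 0 ≤ m v := by
    intro v hv
    have h1 := hle (R.erase v) (Finset.erase_subset _ _)
    rw [← Finset.add_sum_erase R m hv] at hsum
    have h2 : ((A.filter fun e => ∃ w ∈ N e, w ∈ R.erase v).card : ℤ) ≤ A.card :=
      Nat.cast_le.2 (Finset.card_filter_le _ _)
    linarith
  -- Hall's theorem matches `m v` copies of each `v` into `A`. There are `A.card` copies in all, so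
  -- the matching exhausts `A`.
  let t : (Σ v : R, Fin (m v).toNat) → Finset E := fun i => A.filter fun e => (i.1 : V) ∈ N e
  have hfib : ∀ (s : Finset (Σ v : R, Fin (m v).toNat)) (v : R),
      ((s.filter fun i => i.1 = v).card : ℤ) ≤ m v := by
    intro s v
    have h1 : (s.filter fun i => i.1 = v) ⊆
        (Finset.univ : Finset (Fin (m v).toNat)).image (Sigma.mk v) := by
      rintro ⟨w, i⟩ hi
      obtain rfl : w = v := (Finset.mem_filter.1 hi).2
      simp
    have h2 := (Finset.card_le_card h1).trans Finset.card_image_le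
    rw [Finset.card_univ, Fintype.card_fin] at h2
    have := hnn v v.2
    omega
  obtain ⟨f, hf, hft⟩ := (Finset.all_card_le_biUnion_card_iff_exists_injective t).1 (by
    intro s
    have h1 : (s.card : ℤ) ≤ ∑ v ∈ s.image Sigma.fst, m (v : V) := by
      rw [Finset.card_eq_sum_card_image Sigma.fst s]
      push_cast
      exact Finset.sum_le_sum fun v _ => hfib s v
    have h2 := hle ((s.image Sigma.fst).map (Function.Embedding.subtype _)) (by
      intro v hv
      obtain ⟨w, -, rfl⟩ := Finset.mem_map.1 hv
      exact w.2)
    rw [Finset.sum_map] at h2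
    have h3 : (A.filter fun e => ∃ v ∈ N e,
        v ∈ (s.image Sigma.fst).map (Function.Embedding.subtype _)) ⊆ s.biUnion t := by
      intro e he
      obtain ⟨heA, v, hv, hvs⟩ := Finset.mem_filter.1 he
      obtain ⟨w, hw, rfl⟩ := Finset.mem_map.1 hvs
      obtain ⟨i, hi, rfl⟩ := Finset.mem_image.1 hw
      exact Finset.mem_biUnion.2 ⟨i, hi, Finset.mem_filter.2 ⟨heA, hv⟩⟩
    have h4 := Finset.card_le_card h3
    simp only [Function.Embedding.subtype_apply] at h2
    omega)
  have hcard : Fintype.card (Σ v : R, Fin (m v).toNat) = A.card := by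
    zify
    rw [← hsum, Fintype.card_sigma, ← Finset.sum_coe_sort R m]
    push_cast
    refine Finset.sum_congr rfl fun v _ => ?_
    rw [Fintype.card_fin]
    exact Int.toNat_of_nonneg (hnn v v.2)
  have himg : Finset.univ.image f = A := by
    refine Finset.eq_of_subset_of_card_le ?_ ?_
    · intro e he
      obtain ⟨i, -, rfl⟩ := Finset.mem_image.1 he
      exact (Finset.mem_filter.1 (hft i)).1
    · rw [Finset.card_image_of_injective _ hf, Finset.card_univ, hcard]
  have hinv : ∀ e : E, ∃ v : V, e ∈ A → ∃ i, f i = e ∧ (i.1 : V) = v := by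
    intro e
    by_cases he : e ∈ A
    · rw [← himg] at he
      obtain ⟨i, -, rfl⟩ := Finset.mem_image.1 he
      exact ⟨i.1, fun _ => ⟨i, rfl, rfl⟩⟩
    · exact ⟨Classical.arbitrary V, fun h => absurd h he⟩
  choose h hh using hinv
  refine ⟨h, ?_, ?_⟩
  · intro e he
    obtain ⟨i, rfl, hi⟩ := hh e he
    rw [← hi]
    exact ⟨(Finset.mem_filter.1 (hft i)).2, i.1.2⟩
  · intro v hv
    have h1 : (A.filter fun e => h e = v) =
        ((Finset.univ : Finset (Fin (m v).toNat)).image fun i =>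
          (⟨⟨v, hv⟩, i⟩ : Σ v : R, Fin (m v).toNat)).image f := by
      ext e
      simp only [Finset.mem_filter, Finset.mem_image, Finset.mem_univ, true_and,
        exists_exists_eq_and]
      constructor
      · rintro ⟨he, rfl⟩
        obtain ⟨⟨⟨w, hw⟩, i⟩, h1, h2⟩ := hh e he
        simp only at h2
        subst h2
        exact ⟨i, h1⟩
      · rintro ⟨i, rfl⟩
        have he : f ⟨⟨v, hv⟩, i⟩ ∈ A := (Finset.mem_filter.1 (hft _)).1
        refine ⟨he, ?_⟩
        obtain ⟨j, h1, h2⟩ := hh _ he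
        rw [← h2, hf h1]
    rw [h1, Finset.card_image_of_injective _ hf,
      Finset.card_image_of_injective _ sigma_mk_injective, Finset.card_univ, Fintype.card_fin]
    exact Int.toNat_of_nonneg (hnn v hv)

/-- The counting inequality at a vertex outside the terminal set. -/
lemma sum_ite_vertex_contribution_nonneg {ι : Type*} [DecidableEq ι] (P : Finset ι) (p : ι → Prop)
    [DecidablePred p] (d y : ι → ℤ) (D h c : ℤ) (hd : ∀ i ∈ P, 0 ≤ d i) (hyd : ∀ i ∈ P, y i ≤ d i)
    (hyD : ∀ i ∈ P, y i ≤ D - d i) (hyh : ∀ i ∈ P, y i ≤ h) (hh : 2 * h ≤ D) (hh0 : 0 ≤ h)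
    (hc : 0 ≤ c) (hD : D ≤ ∑ i ∈ P, d i + c) :
    2 * h ≤ (∑ i ∈ P, if p i then 2 * h - y i else 2 * d i - y i) + c := by
  set f : ι → ℤ := fun i => if p i then 2 * h - y i else 2 * d i - y i with hf
  have hpos : ∀ i ∈ P, 0 ≤ f i := by
    intro i hi
    have h1 := hd i hi
    have h2 := hyd i hi
    have h3 := hyh i hi
    simp only [hf]
    split_ifs <;> linarith
  -- Two indices satisfying `p` contribute at least `h` each. If `i` is the only one, the others and
  -- `c` contribute at least `D - d i`, which covers `y i`. If there is none, the total is at least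
  -- `D`.
  by_cases h0 : ∃ i ∈ P, p i
  · obtain ⟨i, hi, hpi⟩ := h0
    rw [← Finset.add_sum_erase P f hi]
    have hfi : f i = 2 * h - y i := by simp [hf, hpi]
    by_cases h1 : ∃ j ∈ P.erase i, p j
    · obtain ⟨j, hj, hpj⟩ := h1
      have hfj : f j = 2 * h - y j := by simp [hf, hpj]
      have h2 := Finset.single_le_sum (f := f)
        (fun l hl => hpos l (Finset.mem_of_mem_erase hl)) hj
      have h3 := hyh i hi
      have h4 := hyh j (Finset.mem_of_mem_erase hj)
      linarith
    · push Not at h1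
      have h2 : ∑ j ∈ P.erase i, d j ≤ ∑ j ∈ P.erase i, f j := by
        refine Finset.sum_le_sum fun j hj => ?_
        have := hyd j (Finset.mem_of_mem_erase hj)
        simp only [hf, h1 j hj, if_false]
        linarith
      rw [← Finset.add_sum_erase P d hi] at hD
      have h3 := hyD i hi
      linarith
  · push Not at h0
    have h2 : ∑ j ∈ P, d j ≤ ∑ j ∈ P, f j := by
      refine Finset.sum_le_sum fun j hj => ?_
      have := hyd j hj
      simp only [hf, h0 j hj, if_false]
      linarith
    linarith

/-! ### Starlike hypergraphs: from in-degrees to orientations -/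

namespace MultiHypergraph

variable {V E : Type*} [DecidableEq V] [Fintype E]

/-- The hyperedges that meet `X`. -/
def touching (G : MultiHypergraph V E) (X : Finset V) : Finset E :=
  Finset.univ.filter fun e => ∃ v ∈ G.ends e, v ∈ X

/-- The hyperedges that contain `u` and meet `X`. -/
def linking (G : MultiHypergraph V E) (u : V) (X : Finset V) : Finset E :=
  Finset.univ.filter fun e => u ∈ G.ends e ∧ ∃ v ∈ G.ends e, v ∈ X

/-- Every hyperedge that contains a vertex `v` outside `T` consists of `v` and at most one vertex
of `T`. -/
def IsStarlike (G : MultiHypergraph V E) (T : Finset V) : Prop :=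
  ∀ e, ∀ v ∈ G.ends e, v ∉ T → ∃ t ∈ T, G.ends e ⊆ {v, t}

/-- The number of hyperedges that are oriented towards a vertex outside the terminal set. -/
def halfDegree (G : MultiHypergraph V E) (T : Finset V) (u : V) : ℤ :=
  (G.touching {u}).card - ((G.linking u T).card / 2 : ℕ)

lemma mem_touching {G : MultiHypergraph V E} {X : Finset V} {e : E} :
    e ∈ G.touching X ↔ ∃ v ∈ G.ends e, v ∈ X := by
  simp [touching]

lemma mem_touching_singleton {G : MultiHypergraph V E} {u : V} {e : E} :
    e ∈ G.touching {u} ↔ u ∈ G.ends e := by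
  simp [touching]

lemma mem_linking {G : MultiHypergraph V E} {u : V} {X : Finset V} {e : E} :
    e ∈ G.linking u X ↔ u ∈ G.ends e ∧ ∃ v ∈ G.ends e, v ∈ X := by
  simp [linking]

lemma mem_linking_singleton {G : MultiHypergraph V E} {u v : V} {e : E} :
    e ∈ G.linking u {v} ↔ u ∈ G.ends e ∧ v ∈ G.ends e := by
  simp [linking]

lemma card_touching_submodular (G : MultiHypergraph V E) (P Q : Finset V) :
    (G.touching (P ∩ Q)).card + (G.touching (P ∪ Q)).card ≤
      (G.touching P).card + (G.touching Q).card := by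
  classical
  rw [← Finset.card_union_add_card_inter (G.touching (P ∩ Q)),
    ← Finset.card_union_add_card_inter (G.touching P)]
  apply add_le_add <;> apply Finset.card_le_card <;> intro e <;>
    simp only [Finset.mem_union, Finset.mem_inter, mem_touching]
  · rintro (⟨v, hv, hP, hQ⟩ | ⟨v, hv, hP | hQ⟩)
    · exact Or.inl ⟨v, hv, hP⟩
    · exact Or.inl ⟨v, hv, hP⟩
    · exact Or.inr ⟨v, hv, hQ⟩
  · rintro ⟨⟨v, hv, hP, hQ⟩, -⟩
    exact ⟨⟨v, hv, hP⟩, v, hv, hQ⟩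

section

variable {G : MultiHypergraph V E} {T : Finset V} {r : V} {k : ℕ} {F : Finset E}

lemma IsStarlike.eq_of_mem {V E : Type*} [DecidableEq V]
    {G : MultiHypergraph V E} {T : Finset V} (hE : G.IsStarlike T) {e : E} {u v : V} (hu : u ∈ G.ends e)
    (huT : u ∉ T) (hv : v ∈ G.ends e) (hvT : v ∉ T) : u = v := by
  obtain ⟨t, ht, hsub⟩ := hE e u hu huT
  have := hsub hv
  simp only [Finset.mem_insert, Finset.mem_singleton] at this
  rcases this with h | h
  · exact h.symm
  · exact absurd (h ▸ ht) hvT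

lemma IsStarlike.eq_of_mem_terminal {V E : Type*} [DecidableEq V]
    {G : MultiHypergraph V E} {T : Finset V} (hE : G.IsStarlike T) {e : E} {u s t : V} (hu : u ∈ G.ends e)
    (huT : u ∉ T) (hs : s ∈ G.ends e) (hsT : s ∈ T) (ht : t ∈ G.ends e) (htT : t ∈ T) :
    s = t := by
  obtain ⟨w, -, hsub⟩ := hE e u hu huT
  have h1 := hsub hs
  have h2 := hsub ht
  simp only [Finset.mem_insert, Finset.mem_singleton] at h1 h2
  rcases h1 with rfl | rfl
  · exact absurd hsT huT
  · rcases h2 with rfl | rfl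
    · exact absurd htT huT
    · rfl

/-- If more than half of the links of `u` went to the root, merging `u` with the root would bring
its degree below `2k`. -/
lemma IsRootedInstance.two_mul_card_linking_root_le [Fintype V] (hG : G.IsRootedInstance T r k F)
    (hE : G.IsStarlike T) {u : V} (hu : u ∉ T) :
    2 * (G.linking u {r}).card ≤ (G.linking u T).card := by
  classical
  obtain ⟨t, ht, htr⟩ := hG.exists_terminal
  have hur : u ≠ r := fun h => hu (h ▸ hG.root_mem)
  have h1 := hG.cut ({r, u} : Finset V)ᶜ (by simp) ⟨t, ht, by
    simp only [Finset.mem_compl, Finset.mem_insert, Finset.mem_singleton, not_or]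
    exact ⟨htr, fun h => hu (h ▸ ht)⟩⟩
  rw [cutDegree, boundary_compl] at h1
  have hsub₁ : G.linking u {r} ⊆ G.boundary {r} := by
    intro e he
    rw [mem_linking_singleton] at he
    exact mem_boundary.2 ⟨⟨r, he.2, by simp⟩, u, he.1, by simpa using hur⟩
  have hsub₂ : G.linking u {r} ⊆ G.linking u T := by
    intro e he
    rw [mem_linking_singleton] at he
    exact mem_linking.2 ⟨he.1, r, he.2, hG.root_mem⟩
  have hsub₃ : G.boundary {r, u} ⊆
      (G.boundary {r} \ G.linking u {r}) ∪ (G.linking u T \ G.linking u {r}) := by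
    intro e he
    obtain ⟨⟨a, ha, ha'⟩, b, hb, hb'⟩ := mem_boundary.1 he
    simp only [Finset.mem_insert, Finset.mem_singleton, not_or] at ha' hb'
    have hnot : e ∉ G.linking u {r} := by
      intro h0
      rw [mem_linking_singleton] at h0
      by_cases hbT : b ∈ T
      · exact hb'.1 (hE.eq_of_mem_terminal h0.1 hu hb hbT h0.2 hG.root_mem)
      · exact hb'.2 (hE.eq_of_mem hb hbT h0.1 hu)
    rw [Finset.mem_union, Finset.mem_sdiff, Finset.mem_sdiff]
    rcases ha' with rfl | rfl
    · exact Or.inl ⟨mem_boundary.2 ⟨⟨a, ha, by simp⟩, b, hb, by simpa using hb'.1⟩, hnot⟩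
    · refine Or.inr ⟨mem_linking.2 ⟨ha, b, hb, ?_⟩, hnot⟩
      by_contra hbT
      exact hb'.2 (hE.eq_of_mem hb hbT ha hu)
  have h2 := (Finset.card_le_card hsub₃).trans (Finset.card_union_le _ _)
  rw [Finset.card_sdiff_of_subset hsub₁, Finset.card_sdiff_of_subset hsub₂] at h2
  have h3 := hG.root_degree
  have h4 := Finset.card_le_card hsub₁
  have h5 := Finset.card_le_card hsub₂
  unfold cutDegree at h3
  omega

/-- Hyperedges at different non-terminals are distinct, so a single `u` suffices. At most half of
its links go to the root, hence the hyperedges at `u` avoiding the root can supply its in-degree. -/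
lemma IsRootedInstance.sum_halfDegree_le [Fintype V] (hG : G.IsRootedInstance T r k F)
    (hE : G.IsStarlike T) {A : Finset V} (hA : ∀ u ∈ A, u ∉ T) :
    ∑ u ∈ A, G.halfDegree T u ≤
      (Finset.univ.filter fun e => r ∉ G.ends e ∧ ∃ v ∈ G.ends e, v ∈ A).card := by
  classical
  have h1 : (Finset.univ.filter fun e => r ∉ G.ends e ∧ ∃ v ∈ G.ends e, v ∈ A) =
      A.biUnion fun u => G.touching {u} \ G.linking u {r} := by
    ext e
    simp only [Finset.mem_filter, Finset.mem_univ, true_and, Finset.mem_biUnion,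
      Finset.mem_sdiff, mem_touching_singleton, mem_linking_singleton]
    constructor
    · rintro ⟨h1, u, hu, huA⟩
      exact ⟨u, huA, hu, fun h => h1 h.2⟩
    · rintro ⟨u, huA, hu, h1⟩
      exact ⟨fun h => h1 ⟨hu, h⟩, u, hu, huA⟩
  rw [h1, Finset.card_biUnion]
  · push_cast
    refine Finset.sum_le_sum fun u hu => ?_
    have h2 := hG.two_mul_card_linking_root_le hE (hA u hu)
    have h3 : G.linking u {r} ⊆ G.touching {u} := fun e he =>
      mem_touching_singleton.2 (mem_linking_singleton.1 he).1
    rw [Finset.card_sdiff_of_subset h3, Nat.cast_sub (Finset.card_le_card h3), halfDegree]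
    omega
  · intro u hu v hv huv
    rw [Function.onFun, Finset.disjoint_left]
    intro e he hev
    rw [Finset.mem_sdiff, mem_touching_singleton] at he hev
    exact huv (hE.eq_of_mem he.1 (hA u hu) hev.1 (hA v hv))

/-- The hyperedges that are not directed towards the root. -/
lemma IsRootedInstance.card_filter_not_root [Fintype V] [DecidableEq E] (hG : G.IsRootedInstance T r k F) :
    (Finset.univ.filter fun e => r ∈ G.ends e → e ∈ F).card + k +
      (Finset.univ.filter fun e => G.ends e = {r}).card = Fintype.card E := by
  classical
  have h1 := hG.root_degree
  unfold cutDegree at h1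
  have h2 := Finset.card_sdiff_of_subset hG.subset
  rw [hG.card] at h2
  have h3 : (Finset.univ.filter fun e => r ∈ G.ends e → e ∈ F)ᶜ =
      (G.boundary {r} \ F) ∪ (Finset.univ.filter fun e => G.ends e = {r}) := by
    ext e
    simp only [Finset.mem_compl, Finset.mem_filter, Finset.mem_univ, true_and, Finset.mem_union,
      Finset.mem_sdiff, mem_boundary, Finset.mem_singleton]
    constructor
    · intro h
      push Not at h
      by_cases h4 : G.ends e = {r}
      · exact Or.inr h4
      · refine Or.inl ⟨⟨⟨r, h.1, rfl⟩, ?_⟩, h.2⟩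
        by_contra! h5
        exact h4 (Finset.eq_singleton_iff_unique_mem.2 ⟨h.1, h5⟩)
    · rintro (⟨⟨⟨_, h4, rfl⟩, -⟩, h5⟩ | h4)
      · exact fun h => h5 (h h4)
      · intro h
        obtain ⟨-, w, hw, hwr⟩ := mem_boundary.1 (hG.subset (h (by simp [h4])))
        rw [h4] at hw
        exact hwr hw
  have h4 : Disjoint (G.boundary {r} \ F) (Finset.univ.filter fun e => G.ends e = {r}) := by
    rw [Finset.disjoint_left]
    intro e he he'
    obtain ⟨-, w, hw, hwr⟩ := mem_boundary.1 (Finset.mem_sdiff.1 he).1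
    rw [(Finset.mem_filter.1 he').2] at hw
    exact hwr hw
  have h5 := Finset.card_add_card_compl (Finset.univ.filter fun e => r ∈ G.ends e → e ∈ F)
  rw [h3, Finset.card_union_of_disjoint h4] at h5
  omega

/-- Turning an in-degree vector into an orientation. -/
lemma IsRootedInstance.exists_orientation_of_vector [Fintype V] [DecidableEq E]
    (hG : G.IsRootedInstance T r k F)
    (hE : G.IsStarlike T) (m : V → ℤ) (hm₀ : ∀ v, v ∉ T → m v = G.halfDegree T v)
    (hm : ∀ X, r ∉ X → (∃ t ∈ T, t ∈ X) → ∑ v ∈ X, m v ≤ (G.touching X).card - k)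
    (hsum : ∑ v ∈ ({r}ᶜ : Finset V), m v =
      (Finset.univ.filter fun e => r ∈ G.ends e → e ∈ F).card) :
    ∃ h, G.IsRootedOrientation T r k F h := by
  classical
  set A : Finset E := Finset.univ.filter fun e => r ∈ G.ends e → e ∈ F with hA
  have hmA : ∀ e, e ∈ A ↔ (r ∈ G.ends e → e ∈ F) := fun e => by simp [hA]
  have hcomplA : (G.boundary {r} \ F).card = k := by
    have := hG.root_degree
    unfold cutDegree at this
    rw [Finset.card_sdiff_of_subset hG.subset, hG.card]
    omega
  have : Nonempty V := ⟨r⟩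
  have hU : ∀ X : Finset V, (∀ v ∈ X, v ∉ T) → ∑ v ∈ X, m v ≤
      (Finset.univ.filter fun e => r ∉ G.ends e ∧ ∃ v ∈ G.ends e, v ∈ X).card := by
    intro X hX
    rw [Finset.sum_congr rfl fun v hv => hm₀ v (hX v hv)]
    exact hG.sum_halfDegree_le hE hX
  obtain ⟨h, hh, hhm⟩ := exists_choice_with_multiplicities A G.ends ({r}ᶜ : Finset V) m hsum (by
    intro X hX
    have hrX : r ∉ X := fun h0 => by simpa using hX h0
    by_cases hT : ∃ t ∈ T, t ∈ X
    · refine (hm X hrX hT).trans ?_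
      -- Among the hyperedges meeting `X`, only the `k` boundary hyperedges directed to the root are
      -- unavailable; the term `-k` in the bound pays for them.
      have h1 : G.touching X ⊆ (A.filter fun e => ∃ v ∈ G.ends e, v ∈ X) ∪
          (G.boundary {r} \ F) := by
        intro e he
        rw [mem_touching] at he
        rw [Finset.mem_union, Finset.mem_filter, hmA, Finset.mem_sdiff, mem_boundary]
        by_cases h2 : r ∈ G.ends e → e ∈ F
        · exact Or.inl ⟨h2, he⟩
        · push Not at h2
          obtain ⟨v, hv, hvX⟩ := he
          exact Or.inr ⟨⟨⟨r, h2.1, by simp⟩, v, hv, by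
            rw [Finset.mem_singleton]
            exact fun h0 => hrX (h0 ▸ hvX)⟩, h2.2⟩
      have h2 := (Finset.card_le_card h1).trans (Finset.card_union_le _ _)
      omega
    · push Not at hT
      refine (hU X fun v hv hvT => hT v hvT hv).trans (Nat.cast_le.2 (Finset.card_le_card ?_))
      intro e he
      simp only [Finset.mem_filter, Finset.mem_univ, true_and, hmA] at he ⊢
      exact ⟨fun h0 => absurd h0 he.1, he.2⟩)
  set g : E → V := fun e => if e ∈ A then h e else r with hg
  have hgA : ∀ e ∈ A, g e = h e := fun e he => by simp [hg, he]
  have hgA' : ∀ e, e ∉ A → g e = r := fun e he => by simp [hg, he]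
  have hgr : ∀ e ∈ A, g e ≠ r := fun e he => by
    rw [hgA e he]
    simpa using (hh e he).2
  have hcount : ∀ X : Finset V, r ∉ X →
      ((Finset.univ.filter fun e => g e ∈ X).card : ℤ) = ∑ v ∈ X, m v := by
    intro X hrX
    have h1 : (Finset.univ.filter fun e => g e ∈ X) =
        X.biUnion fun v => A.filter fun e => h e = v := by
      ext e
      simp only [Finset.mem_filter, Finset.mem_univ, true_and, Finset.mem_biUnion,
        exists_eq_right_right']
      by_cases he : e ∈ A
      · rw [hgA e he]
        simp [he]
      · rw [hgA' e he]
        simp [he, hrX]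
    rw [h1, Finset.card_biUnion]
    · push_cast
      refine Finset.sum_congr rfl fun v hv => hhm v ?_
      simp only [Finset.mem_compl, Finset.mem_singleton]
      exact fun h0 => hrX (h0 ▸ hv)
    · intro u _ v _ huv
      rw [Function.onFun, Finset.disjoint_left]
      intro e he hev
      exact huv ((Finset.mem_filter.1 he).2.symm.trans (Finset.mem_filter.1 hev).2)
  have hgmem : ∀ e, g e ∈ G.ends e := by
    intro e
    by_cases he : e ∈ A
    · rw [hgA e he]
      exact (hh e he).1
    · rw [hgA' e he]
      rw [hmA] at he
      push Not at he
      exact he.1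
  have hout : ∀ X : Finset V, G.outDegree g X + (Finset.univ.filter fun e => g e ∈ X).card =
      (G.touching X).card := by
    intro X
    rw [outDegree, ← Finset.card_union_of_disjoint]
    · congr 1
      ext e
      simp only [Finset.mem_union, mem_outArcs, Finset.mem_filter, Finset.mem_univ, true_and,
        mem_touching]
      by_cases he : g e ∈ X
      · simp only [he, not_true_eq_false, and_false, or_true, true_iff]
        exact ⟨g e, hgmem e, he⟩
      · simp [he]
    · rw [Finset.disjoint_left]
      intro e he he'
      exact (mem_outArcs.1 he).2 (Finset.mem_filter.1 he').2
  refine ⟨g, hgmem, ?_, ?_, ?_⟩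
  · intro e he
    by_cases heA : e ∈ A
    · exact iff_of_false (hgr e heA) (not_not.2 ((hmA e).1 heA he))
    · refine iff_of_true (hgA' e heA) fun h0 => heA ((hmA e).2 fun _ => h0)
  · intro X hrX hT
    have h1 := hm X hrX hT
    have h2 := hcount X hrX
    have h3 := hout X
    omega
  · intro X hrX hT
    have h1 := hout X
    have hX : ∀ v ∈ X.erase r, v ∉ T := fun v hv hvT =>
      (Finset.mem_erase.1 hv).1 (hT v hvT (Finset.mem_erase.1 hv).2)
    have h2 := hU (X.erase r) hX
    rw [← hcount (X.erase r) (by simp)] at h2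
    -- Heads in `X` are paid for by the hyperedges meeting `X` that avoid `r` and by those through
    -- `r` outside `F`. The `k` members of `F` also meet `X` and form the surplus.
    have h3 : (Finset.univ.filter fun e => g e ∈ X) ⊆
        (Finset.univ.filter fun e => g e ∈ X.erase r) ∪
          (Finset.univ.filter fun e => r ∈ G.ends e ∧ e ∉ F) := by
      intro e he
      simp only [Finset.mem_filter, Finset.mem_univ, true_and, Finset.mem_union,
        Finset.mem_erase] at he ⊢
      by_cases heA : e ∈ A
      · exact Or.inl ⟨hgr e heA, he⟩
      · rw [hmA] at heA
        push Not at heA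
        exact Or.inr heA
    have h4 : ((Finset.univ.filter fun e => r ∉ G.ends e ∧ ∃ v ∈ G.ends e, v ∈ X.erase r) ∪
        (Finset.univ.filter fun e => r ∈ G.ends e ∧ e ∉ F)) ∪ F ⊆ G.touching X := by
      intro e he
      simp only [Finset.mem_filter, Finset.mem_univ, true_and, Finset.mem_union,
        Finset.mem_erase, mem_touching] at he ⊢
      rcases he with (⟨-, v, hv, -, hvX⟩ | ⟨hr, -⟩) | hF
      · exact ⟨v, hv, hvX⟩
      · exact ⟨r, hr, hrX⟩
      · obtain ⟨⟨v, hv, hvr⟩, -⟩ := mem_boundary.1 (hG.subset hF)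
        rw [Finset.mem_singleton] at hvr
        exact ⟨r, hvr ▸ hv, hrX⟩
    have hFr : ∀ e ∈ F, r ∈ G.ends e := by
      intro e hF
      obtain ⟨⟨v, hv, hvr⟩, -⟩ := mem_boundary.1 (hG.subset hF)
      rw [Finset.mem_singleton] at hvr
      exact hvr ▸ hv
    have h5 := Finset.card_le_card h4
    rw [Finset.card_union_of_disjoint, Finset.card_union_of_disjoint, hG.card] at h5
    · have h6 := (Finset.card_le_card h3).trans (Finset.card_union_le _ _)
      omega
    · rw [Finset.disjoint_left]
      intro e he he'
      exact (Finset.mem_filter.1 he).2.1 (Finset.mem_filter.1 he').2.1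
    · rw [Finset.disjoint_left]
      intro e he he'
      simp only [Finset.mem_filter, Finset.mem_univ, true_and, Finset.mem_union] at he
      have := hFr e he'
      tauto

end

end MultiHypergraph

/-! ### Counting over the tight partition -/

namespace MultiHypergraph

variable {V E : Type*} [Fintype V] [DecidableEq V] [Fintype E]

/-- The set with the terminals of `X` and those other vertices that have more than half of their
links in `X`. -/
def majorityExtension (G : MultiHypergraph V E) (T X : Finset V) : Finset V :=
  Finset.univ.filter fun v =>
    (v ∈ T ∧ v ∈ X) ∨ (v ∉ T ∧ (G.linking v T).card < 2 * (G.linking v (X ∩ T)).card)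

/-- Twice the contribution of the hyperedge `e` to the surplus of the bounds given by the family `P`
over the number of hyperedges to be oriented. -/
def surplus (G : MultiHypergraph V E) [DecidableEq E] (T : Finset V) (r : V)
    (P : Finset (Finset V)) (e : E) : ℤ :=
  ∑ X ∈ P, (2 * (if e ∈ G.touching X then 1 else 0) -
      (if e ∈ G.boundary (G.majorityExtension T X) then 1 else 0)) -
    2 + 2 * (if G.ends e = {r} then 1 else 0) + (if e ∈ G.boundary {r} then 1 else 0)

variable [DecidableEq E] {G : MultiHypergraph V E} {T : Finset V} {r : V} {k : ℕ} {F : Finset E}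
  {P : Finset (Finset V)}

lemma mem_majorityExtension_of_mem {V E : Type*} [Fintype V] [DecidableEq V] [Fintype E]
    {G : MultiHypergraph V E} {T X : Finset V} {v : V} (hv : v ∈ T) :
    v ∈ G.majorityExtension T X ↔ v ∈ X := by
  simp [majorityExtension, hv]

lemma mem_majorityExtension_of_notMem {V E : Type*} [Fintype V] [DecidableEq V] [Fintype E]
    {G : MultiHypergraph V E} {T X : Finset V} {v : V} (hv : v ∉ T) :
    v ∈ G.majorityExtension T X ↔ (G.linking v T).card < 2 * (G.linking v (X ∩ T)).card := by
  simp [majorityExtension, hv]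

/-- On terminals the majority extension agrees with `X`. A member of `P` containing all of `e`
contributes two; otherwise one that meets `e` contributes at least one, and the missing unit comes
from a second member or from the boundary of the root. -/
lemma surplus_nonneg_of_subset (hne : ∀ e, (G.ends e).Nonempty)
    (hcov : ∀ s ∈ T.erase r, ∃ X ∈ P, s ∈ X) {e : E} (he : G.ends e ⊆ T) :
    0 ≤ G.surplus T r P e := by
  set f : Finset V → ℤ := fun X => 2 * (if e ∈ G.touching X then 1 else 0) -
      (if e ∈ G.boundary (G.majorityExtension T X) then 1 else 0) with hf
  have hsur : G.surplus T r P e = ∑ X ∈ P, f X - 2 + 2 * (if G.ends e = {r} then 1 else 0) +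
    (if e ∈ G.boundary {r} then 1 else 0) := rfl
  have hbt : ∀ X, e ∈ G.boundary (G.majorityExtension T X) → e ∈ G.touching X := by
    intro X h0
    obtain ⟨⟨v, hv, hvX⟩, -⟩ := mem_boundary.1 h0
    exact mem_touching.2 ⟨v, hv, (mem_majorityExtension_of_mem (he hv)).1 hvX⟩
  have hf0 : ∀ X ∈ P, 0 ≤ f X := by
    intro X _
    have := hbt X
    simp only [hf]
    split_ifs <;> simp_all
  have hf1 : ∀ X, e ∈ G.touching X → 1 ≤ f X := by
    intro X hX
    simp only [hf, hX, if_true]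
    split_ifs <;> norm_num
  rw [hsur]
  by_cases her : G.ends e = {r}
  · have := Finset.sum_nonneg hf0
    rw [if_pos her]
    split_ifs <;> linarith
  rw [if_neg her]
  obtain ⟨s, hs, hsr⟩ : ∃ s ∈ G.ends e, s ≠ r := by
    by_contra! hcon
    obtain ⟨w, hw⟩ := hne e
    exact her (Finset.eq_singleton_iff_unique_mem.2 ⟨hcon w hw ▸ hw, hcon⟩)
  obtain ⟨X, hX, hsX⟩ := hcov s (Finset.mem_erase.2 ⟨hsr, he hs⟩)
  have hsum := Finset.single_le_sum hf0 hX
  have htX : e ∈ G.touching X := mem_touching.2 ⟨s, hs, hsX⟩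
  by_cases hall : G.ends e ⊆ X
  · have : f X = 2 := by
      have : e ∉ G.boundary (G.majorityExtension T X) := by
        intro h0
        obtain ⟨-, v, hv, hvX⟩ := mem_boundary.1 h0
        exact hvX ((mem_majorityExtension_of_mem (he hv)).2 (hall hv))
      simp [hf, htX, this]
    split_ifs <;> linarith
  · obtain ⟨w, hw, hwX⟩ := Finset.not_subset.1 hall
    have h1 := hf1 X htX
    by_cases hwr : w = r
    · have : e ∈ G.boundary {r} :=
        mem_boundary.2 ⟨⟨w, hw, by simp [hwr]⟩, s, hs, by simpa using hsr⟩
      rw [if_pos this]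
      linarith
    · obtain ⟨Y, hY, hwY⟩ := hcov w (Finset.mem_erase.2 ⟨hwr, he hw⟩)
      have hYX : Y ≠ X := fun h0 => hwX (h0 ▸ hwY)
      have h2 := hf1 Y (mem_touching.2 ⟨w, hw, hwY⟩)
      have h3 := Finset.single_le_sum (f := f)
        (fun Z hZ => hf0 Z (Finset.mem_of_mem_erase hZ)) (Finset.mem_erase.2 ⟨hYX, hY⟩)
      rw [← Finset.add_sum_erase P f hX]
      split_ifs <;> linarith

/-- This is `sum_ite_vertex_contribution_nonneg` for the links at `u`: `D` in total, `d X` into `X`,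
`y X` cut by the majority extension, `h = ⌊D / 2⌋`, and `c` the number of links to the root. -/
lemma sum_surplus_vertex_nonneg (hE : G.IsStarlike T) (hrT : r ∈ T)
    (hcov : ∀ s ∈ T.erase r, ∃ X ∈ P, s ∈ X) {u : V} (hu : u ∉ T) :
    0 ≤ ∑ e ∈ G.touching {u}, G.surplus T r P e +
      2 * (G.halfDegree T u - ∑ X ∈ P, if u ∈ X then G.halfDegree T u else 0) := by
  set D : ℕ := (G.linking u T).card with hD
  set d : Finset V → ℤ := fun X => (G.linking u (X ∩ T)).card with hd
  set y : Finset V → ℤ := fun X =>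
    ((G.touching {u}).filter fun e => e ∈ G.boundary (G.majorityExtension T X)).card with hy
  have hdD : ∀ X, G.linking u (X ∩ T) ⊆ G.linking u T := by
    intro X e he
    obtain ⟨h1, v, hv, hvX⟩ := mem_linking.1 he
    exact mem_linking.2 ⟨h1, v, hv, (Finset.mem_inter.1 hvX).2⟩
  -- The majority rule puts `u` on the side where the fewer links are cut.
  have hyb : ∀ X, y X ≤ d X ∧ y X ≤ D - d X := by
    intro X
    have h1 := Finset.card_le_card (hdD X)
    by_cases huY : u ∈ G.majorityExtension T X
    · have h2 := (mem_majorityExtension_of_notMem hu).1 huY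
      have h3 : ((G.touching {u}).filter fun e => e ∈ G.boundary (G.majorityExtension T X)) ⊆
          G.linking u T \ G.linking u (X ∩ T) := by
        intro e he
        rw [Finset.mem_filter, mem_touching_singleton, mem_boundary] at he
        obtain ⟨hue, -, w, hw, hwX⟩ := he
        have hwT : w ∈ T := by
          by_contra h0
          rw [hE.eq_of_mem hw h0 hue hu] at hwX
          exact hwX huY
        rw [mem_majorityExtension_of_mem hwT] at hwX
        refine Finset.mem_sdiff.2 ⟨mem_linking.2 ⟨hue, w, hw, hwT⟩, ?_⟩
        intro h0
        obtain ⟨-, z, hz, hzX⟩ := mem_linking.1 h0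
        rw [Finset.mem_inter] at hzX
        rw [hE.eq_of_mem_terminal hue hu hw hwT hz hzX.2] at hwX
        exact hwX hzX.1
      have h4 := Finset.card_le_card h3
      rw [Finset.card_sdiff_of_subset (hdD X)] at h4
      simp only [hy, hd, hD]
      omega
    · have h2 := (mem_majorityExtension_of_notMem hu).not.1 huY
      have h3 : ((G.touching {u}).filter fun e => e ∈ G.boundary (G.majorityExtension T X)) ⊆
          G.linking u (X ∩ T) := by
        intro e he
        rw [Finset.mem_filter, mem_touching_singleton, mem_boundary] at he
        obtain ⟨hue, ⟨w, hw, hwX⟩, -⟩ := he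
        have hwT : w ∈ T := by
          by_contra h0
          rw [hE.eq_of_mem hw h0 hue hu] at hwX
          exact huY hwX
        rw [mem_majorityExtension_of_mem hwT] at hwX
        exact mem_linking.2 ⟨hue, w, hw, Finset.mem_inter.2 ⟨hwX, hwT⟩⟩
      have h4 := Finset.card_le_card h3
      simp only [hy, hd, hD]
      omega
  have hcovD : (D : ℤ) ≤ ∑ X ∈ P, d X + (G.linking u {r}).card := by
    have h1 : G.linking u T ⊆ (P.biUnion fun X => G.linking u (X ∩ T)) ∪ G.linking u {r} := by
      intro e he
      obtain ⟨hue, t, ht, htT⟩ := mem_linking.1 he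
      rw [Finset.mem_union]
      by_cases htr : t = r
      · exact Or.inr (mem_linking_singleton.2 ⟨hue, htr ▸ ht⟩)
      · obtain ⟨X, hX, htX⟩ := hcov t (Finset.mem_erase.2 ⟨htr, htT⟩)
        exact Or.inl (Finset.mem_biUnion.2 ⟨X, hX, mem_linking.2
          ⟨hue, t, ht, Finset.mem_inter.2 ⟨htX, htT⟩⟩⟩)
    have h2 := (Finset.card_le_card h1).trans (Finset.card_union_le _ _)
    have h3 : (P.biUnion fun X => G.linking u (X ∩ T)).card ≤
      ∑ X ∈ P, (G.linking u (X ∩ T)).card := Finset.card_biUnion_le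
    simp only [hd, hD]
    exact_mod_cast h2.trans (Nat.add_le_add_right h3 _)
  have hkey := sum_ite_vertex_contribution_nonneg P (fun X => u ∈ X) d y D (D / 2 : ℕ)
    (G.linking u {r}).card (fun X _ => Nat.cast_nonneg _) (fun X _ => (hyb X).1)
    (fun X _ => (hyb X).2) (fun X _ => by have := hyb X; omega) (by omega) (by positivity)
    (by positivity) hcovD
  have hhalf : G.halfDegree T u = (G.touching {u}).card - (D / 2 : ℕ) := rfl
  have hτ : ∀ X, u ∉ X → ((G.touching {u}).filter fun e => e ∈ G.touching X).card =
      (G.linking u (X ∩ T)).card := by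
    intro X huX
    congr 1
    ext e
    rw [Finset.mem_filter, mem_touching_singleton, mem_touching, mem_linking]
    refine and_congr_right fun hue => ⟨?_, ?_⟩
    · rintro ⟨v, hv, hvX⟩
      refine ⟨v, hv, Finset.mem_inter.2 ⟨hvX, ?_⟩⟩
      by_contra h0
      exact huX (hE.eq_of_mem hv h0 hue hu ▸ hvX)
    · rintro ⟨v, hv, hvX⟩
      exact ⟨v, hv, (Finset.mem_inter.1 hvX).1⟩
  have hτ' : ∀ X, u ∈ X → ((G.touching {u}).filter fun e => e ∈ G.touching X).card =
      (G.touching {u}).card := by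
    intro X huX
    congr 1
    rw [Finset.filter_eq_self]
    intro e he
    exact mem_touching.2 ⟨u, mem_touching_singleton.1 he, huX⟩
  have hr : ((G.touching {u}).filter fun e => e ∈ G.boundary {r}).card =
      (G.linking u {r}).card := by
    congr 1
    ext e
    rw [Finset.mem_filter, mem_touching_singleton, mem_boundary, mem_linking]
    refine and_congr_right fun hue => ⟨fun h0 => h0.1, fun h0 => ⟨h0, u, hue, ?_⟩⟩
    rw [Finset.mem_singleton]
    exact fun h1 => hu (h1 ▸ hrT)
  have h0 : ∀ e ∈ G.touching {u}, (if G.ends e = {r} then (1 : ℤ) else 0) = 0 := by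
    intro e he
    rw [if_neg]
    intro h1
    have := mem_touching_singleton.1 he
    rw [h1, Finset.mem_singleton] at this
    exact hu (this ▸ hrT)
  have hsum : ∑ e ∈ G.touching {u}, G.surplus T r P e =
      ∑ X ∈ P, (2 * (((G.touching {u}).filter fun e => e ∈ G.touching X).card : ℤ) - y X) -
        2 * (G.touching {u}).card + (G.linking u {r}).card := by
    unfold surplus
    rw [Finset.sum_add_distrib, Finset.sum_add_distrib, Finset.sum_sub_distrib, Finset.sum_comm,
      ← Finset.mul_sum, Finset.sum_congr rfl h0, Finset.sum_boole, hr]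
    simp only [Finset.sum_sub_distrib, ← Finset.mul_sum, Finset.sum_boole, Finset.sum_const_zero,
      Finset.sum_const, hy]
    simp only [nsmul_eq_mul]
    ring
  rw [hsum]
  -- For `u ∈ X`, subtracting `2 * halfDegree` turns twice the number of hyperedges at `u` into `2 *
  -- ⌊D / 2⌋`.
  have hfin : ∑ X ∈ P, (if u ∈ X then 2 * ((D / 2 : ℕ) : ℤ) - y X else 2 * d X - y X) =
      ∑ X ∈ P, (2 * (((G.touching {u}).filter fun e => e ∈ G.touching X).card : ℤ) - y X) -
        2 * ∑ X ∈ P, (if u ∈ X then G.halfDegree T u else 0) := by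
    rw [Finset.mul_sum, ← Finset.sum_sub_distrib]
    refine Finset.sum_congr rfl fun X _ => ?_
    by_cases huX : u ∈ X
    · rw [if_pos huX, if_pos huX, hτ' X huX, hhalf]
      ring
    · rw [if_neg huX, if_neg huX, hτ X huX]
      ring
  rw [hfin] at hkey
  rw [mul_sub, hhalf]
  rw [hhalf] at hkey
  linarith

/-- The rooted orientation of a hypergraph in which every hyperedge with a vertex outside the
terminal set is a link between that vertex and a terminal. -/
theorem IsRootedInstance.exists_orientation_of_isStarlike (hG : G.IsRootedInstance T r k F)
    (hE : G.IsStarlike T) : ∃ h, G.IsRootedOrientation T r k F h := by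
  have hS : (T.erase r).Nonempty := by
    obtain ⟨t, ht, htr⟩ := hG.exists_terminal
    exact ⟨t, Finset.mem_erase.2 ⟨htr, ht⟩⟩
  obtain ⟨m, hm₀, hm, P, hP, hdisj, hcov⟩ := exists_vector_tight_partition
    (fun X => ((G.touching X).card : ℤ) - k) ({r}ᶜ : Finset V) (T.erase r) hS
    (fun v hv => by simpa using (Finset.mem_erase.1 hv).1) (G.halfDegree T) (by
      intro X Y _ _ _
      have := G.card_touching_submodular X Y
      omega)
  have hm₀' : ∀ v, v ∉ T → m v = G.halfDegree T v :=
    fun v hv => hm₀ v fun h0 => hv (Finset.mem_of_mem_erase h0)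
  have hrP : ∀ X ∈ P, r ∉ X := fun X hX h0 => by simpa using (hP X hX).1 h0
  have hmC : ∀ X, r ∉ X → (∃ t ∈ T, t ∈ X) → ∑ v ∈ X, m v ≤ (G.touching X).card - k := by
    rintro X hrX ⟨t, ht, htX⟩
    refine hm X (fun v hv => ?_) ⟨t, Finset.mem_erase.2 ⟨fun h0 => hrX (h0 ▸ htX), ht⟩, htX⟩
    rw [Finset.mem_compl, Finset.mem_singleton]
    exact fun h0 => hrX (h0 ▸ hv)
  refine hG.exists_orientation_of_vector hE m hm₀' hmC ?_
  have hcard := hG.card_filter_not_root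
  -- The upper bound is the constraint for `{r}ᶜ`. The lower bound is where the tight partition is
  -- needed.
  apply le_antisymm
  · obtain ⟨t, ht, htr⟩ := hG.exists_terminal
    have h1 := hmC {r}ᶜ (by simp) ⟨t, ht, by simpa using htr⟩
    have h2 : (G.touching {r}ᶜ).card + (Finset.univ.filter fun e => G.ends e = {r}).card ≤
        Fintype.card E := by
      rw [← Finset.card_union_of_disjoint]
      · exact Finset.card_le_univ _
      · rw [Finset.disjoint_left]
        intro e he he'
        obtain ⟨v, hv, hvr⟩ := mem_touching.1 he
        rw [(Finset.mem_filter.1 he').2] at hv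
        simp only [Finset.mem_compl] at hvr
        exact hvr hv
    omega
  -- the vector summed over the tight partition
  have hST : ∑ v ∈ T.erase r, m v = ∑ X ∈ P, ∑ v ∈ X ∩ T, m v := by
    rw [← Finset.sum_biUnion]
    · refine Finset.sum_congr ?_ fun _ _ => rfl
      ext s
      simp only [Finset.mem_biUnion, Finset.mem_inter]
      constructor
      · intro hs
        obtain ⟨X, hX, hsX⟩ := hcov s hs
        exact ⟨X, hX, hsX, Finset.mem_of_mem_erase hs⟩
      · rintro ⟨X, hX, hsX, hsT⟩
        exact Finset.mem_erase.2 ⟨fun h0 => hrP X hX (h0 ▸ hsX), hsT⟩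
    · intro X hX Y hY hXY
      rw [Function.onFun, Finset.disjoint_left]
      intro s hs hs'
      rw [Finset.mem_inter] at hs hs'
      exact hXY (hdisj X hX Y hY s
        (Finset.mem_erase.2 ⟨fun h0 => hrP X hX (h0 ▸ hs.1), hs.2⟩) hs.1 hs'.1)
  have hXT : ∀ X ∈ P, ∑ v ∈ X ∩ T, m v = (G.touching X).card - k -
      ∑ u ∈ Tᶜ, if u ∈ X then G.halfDegree T u else 0 := by
    intro X hX
    rw [← (hP X hX).2.2, ← Finset.sum_inter_add_sum_sdiff X T m, ← Finset.sum_filter,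
      add_sub_assoc, left_eq_add, sub_eq_zero]
    refine (Finset.sum_congr ?_ fun v hv => (hm₀' v ?_).symm).symm
    · ext v
      simp [and_comm]
    · exact (Finset.mem_sdiff.1 hv).2
  have hR : ∑ v ∈ ({r}ᶜ : Finset V), m v =
      ∑ v ∈ T.erase r, m v + ∑ u ∈ Tᶜ, G.halfDegree T u := by
    rw [← Finset.sum_congr rfl fun u hu => hm₀' u (Finset.mem_compl.1 hu),
      ← Finset.sum_union]
    · refine Finset.sum_congr ?_ fun _ _ => rfl
      ext v
      simp only [Finset.mem_compl, Finset.mem_singleton, Finset.mem_union, Finset.mem_erase]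
      have : v ∉ T → v ≠ r := fun h0 h1 => h0 (h1 ▸ hG.root_mem)
      tauto
    · rw [Finset.disjoint_left]
      intro v hv hv'
      exact Finset.mem_compl.1 hv' (Finset.mem_of_mem_erase hv)
  -- the cut conditions for the majority extensions
  have hcut : ∀ X ∈ P, (2 * k : ℤ) ≤ G.cutDegree (G.majorityExtension T X) := by
    intro X hX
    obtain ⟨t, ht, htX⟩ := (hP X hX).2.1
    rw [Finset.mem_erase] at ht
    exact_mod_cast hG.cut _ (fun h0 => hrP X hX ((mem_majorityExtension_of_mem hG.root_mem).1 h0))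
      ⟨t, ht.2, (mem_majorityExtension_of_mem ht.2).2 htX⟩
  have hsurplus : ∑ e, G.surplus T r P e = ∑ X ∈ P, (2 * ((G.touching X).card : ℤ) -
      G.cutDegree (G.majorityExtension T X)) - 2 * Fintype.card E +
      2 * (Finset.univ.filter fun e => G.ends e = {r}).card + 2 * k := by
    have h1 := hG.root_degree
    unfold surplus
    unfold cutDegree at *
    rw [Finset.sum_add_distrib, Finset.sum_add_distrib, Finset.sum_sub_distrib, Finset.sum_comm,
      ← Finset.mul_sum, Finset.sum_boole, Finset.sum_boole]
    simp only [Finset.sum_sub_distrib, ← Finset.mul_sum, Finset.sum_boole, Finset.sum_const,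
      Finset.filter_univ_mem, h1]
    simp only [nsmul_eq_mul, Finset.card_univ]
    push_cast
    ring
  have hsplit : ∑ u ∈ Tᶜ, ∑ e ∈ G.touching {u}, G.surplus T r P e ≤ ∑ e, G.surplus T r P e := by
    rw [← Finset.sum_biUnion]
    · refine Finset.sum_le_sum_of_subset_of_nonneg (Finset.subset_univ _) fun e _ he => ?_
      refine surplus_nonneg_of_subset hG.nonempty hcov fun v hv => ?_
      by_contra hvT
      exact he (Finset.mem_biUnion.2 ⟨v, Finset.mem_compl.2 hvT, mem_touching_singleton.2 hv⟩)
    · intro u hu v hv huv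
      rw [Function.onFun, Finset.disjoint_left]
      intro e he he'
      rw [mem_touching_singleton] at he he'
      rw [Finset.mem_coe, Finset.mem_compl] at hu hv
      exact huv (hE.eq_of_mem he hu he' hv)
  have hvert := Finset.sum_nonneg fun u (hu : u ∈ Tᶜ) =>
    sum_surplus_vertex_nonneg (P := P) hE hG.root_mem hcov (Finset.mem_compl.1 hu)
  rw [Finset.sum_add_distrib, ← Finset.mul_sum, Finset.sum_sub_distrib, Finset.sum_comm] at hvert
  -- Replacing `2k` by the cut degree of the majority extension in each tight equality bounds twice
  -- the gap from below by the total surplus plus the vertex corrections, which is nonnegative.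
  have hcutsum := Finset.sum_le_sum hcut
  rw [hR, hST, Finset.sum_congr rfl hXT]
  simp only [Finset.sum_sub_distrib, ← Finset.mul_sum] at hsurplus hvert hcutsum ⊢
  simp only [Finset.sum_const, nsmul_eq_mul] at hsurplus hvert hcutsum ⊢
  zify at hcard
  linarith

end MultiHypergraph

/-! ### The induction and the auxiliary root -/

namespace MultiHypergraph

/-- Every rooted instance has a rooted orientation. -/
theorem IsRootedInstance.exists_orientation {V E : Type*} [Fintype V] [DecidableEq V] [Fintype E]
    {k : ℕ} (hk : 0 < k) (n : ℕ) :
    ∀ (G : MultiHypergraph V E) (T : Finset V) (r : V) (F : Finset E), G.size = n →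
      G.IsRootedInstance T r k F → ∃ h, G.IsRootedOrientation T r k F h := by
  classical
  induction n using Nat.strong_induction_on with
  | _ n ih =>
  rintro G T r F rfl hG
  by_cases hE : G.IsStarlike T
  · exact hG.exists_orientation_of_isStarlike hE
  unfold IsStarlike at hE
  push Not at hE
  obtain ⟨e, v, hv, hvT, he⟩ := hE
  have hvr : v ≠ r := fun h0 => hvT (h0 ▸ hG.root_mem)
  by_cases hcut : ∀ X : Finset V, r ∉ X → (∃ t ∈ T, t ∈ X) → 2 * k ≤ (G.trim e v).cutDegree X
  · obtain ⟨h, hh⟩ := ih _ (size_trim_lt hv) (G.trim e v) T r F rfl (hG.trim hvT he hcut)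
    exact ⟨h, hh.of_trim hvr.symm⟩
  obtain ⟨X, hrX, ⟨t, ht, htX⟩, hX, heX, heX'⟩ := hG.exists_tight hcut
  have hvt : v ≠ t := fun h0 => hvT (h0 ▸ ht)
  have htr : t ≠ r := fun h0 => hrX (h0 ▸ htX)
  have hsupp : ∀ w : V, 2 * k ≤ G.cutDegree {w} → w ∈ G.support := by
    intro w hw
    obtain ⟨f, hf⟩ : (G.boundary {w}).Nonempty := Finset.card_pos.1 (by unfold cutDegree at hw; omega)
    obtain ⟨⟨z, hz, hzw⟩, -⟩ := mem_boundary.1 hf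
    rw [Finset.mem_singleton] at hzw
    exact mem_support.2 ⟨f, hzw ▸ hz⟩
  have htS : t ∈ G.support := hsupp t (hG.cut {t} (by simpa using htr.symm) ⟨t, ht, by simp⟩)
  have hrS : r ∈ G.support := hsupp r hG.root_degree.ge
  -- The vertex `v` is the only vertex of `e` on its side of `X`. As `e` lies neither in `{v, r}`
  -- nor in `{v, t}`, each contraction identifies two distinct vertices of the support and is
  -- smaller.
  have hne : (∃ a ∈ G.support, a ∈ X ∧ a ≠ t) ∧ ∃ b ∈ G.support, b ∉ X ∧ b ≠ r := by
    obtain ⟨w, hw, hwr⟩ := Finset.not_subset.1 (he r hG.root_mem)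
    obtain ⟨z, hz, hzt⟩ := Finset.not_subset.1 (he t ht)
    simp only [Finset.mem_insert, Finset.mem_singleton, not_or] at hwr hzt
    by_cases hvX : v ∈ X
    · refine ⟨⟨v, mem_support.2 ⟨e, hv⟩, hvX, hvt⟩, w, mem_support.2 ⟨e, hw⟩, ?_, hwr.2⟩
      intro hwX
      obtain ⟨-, b, hb, hbX⟩ := mem_boundary.1 heX
      exact heX' (mem_boundary.2 ⟨⟨w, mem_ends_trim.2 ⟨hw, fun _ => hwr.1⟩, hwX⟩, b,
        mem_ends_trim.2 ⟨hb, fun _ h0 => hbX (h0 ▸ hvX)⟩, hbX⟩)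
    · refine ⟨⟨z, mem_support.2 ⟨e, hz⟩, ?_, hzt.2⟩, v, mem_support.2 ⟨e, hv⟩, hvX, hvr⟩
      by_contra hzX
      obtain ⟨⟨b, hb, hbX⟩, -⟩ := mem_boundary.1 heX
      exact heX' (mem_boundary.2 ⟨⟨b, mem_ends_trim.2 ⟨hb, fun _ h0 => hvX (h0 ▸ hbX)⟩, hbX⟩, z,
        mem_ends_trim.2 ⟨hz, fun _ => hzt.1⟩, hzX⟩)
  obtain ⟨⟨a, haS, haX, hat⟩, b, hbS, hbX, hbr⟩ := hne
  have hG₁ := hG.contract_inside hrX htX ht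
  obtain ⟨h₀, hh₀⟩ := ih _ (size_map_lt haS htS hat (by simp [haX, htX])) _ _ r F rfl hG₁
  obtain ⟨h₁, hh₁, hk₁⟩ := IsRootedOrientation.exists_outDegree_eq hG₁ (x := t)
    (by simp [ht]) htr _ h₀ hh₀ rfl
  -- Of the `2k` boundary hyperedges of `X`, exactly `k` leave the contracted vertex, so `k` enter
  -- it.
  have hF' : ((G.boundary X).filter fun e => h₁ e = t).card = k := by
    have h1 : ((G.boundary X).filter fun e => ¬ h₁ e = t) =
        (G.map fun v => if v ∈ X then t else v).outArcs h₁ {t} := by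
      ext f
      simp only [Finset.mem_filter, mem_boundary, mem_outArcs, mem_ends_map,
        Finset.mem_singleton]
      refine and_congr_left fun hf => ⟨?_, ?_⟩
      · rintro ⟨⟨w, hw, hwX⟩, -⟩
        exact ⟨t, ⟨w, hw, if_pos hwX⟩, rfl⟩
      · rintro ⟨_, ⟨w, hw, hwt⟩, rfl⟩
        refine ⟨⟨w, hw, ?_⟩, ?_⟩
        · by_contra hwX
          rw [if_neg hwX] at hwt
          exact hwX (hwt ▸ htX)
        · obtain ⟨z, hz, hz'⟩ := mem_ends_map.1 (hh₁.mem f)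
          refine ⟨z, hz, fun hzX => hf ?_⟩
          rw [← hz', if_pos hzX]
    have h2 := Finset.card_filter_add_card_filter_not (s := G.boundary X) fun e => h₁ e = t
    rw [h1] at h2
    unfold cutDegree at hX
    unfold outDegree at hk₁
    omega
  have hG₂ := hG.contract_outside hrX htX ht hX (Finset.filter_subset _ _) hF'
  obtain ⟨h₂, hh₂⟩ := ih _ (size_map_lt hbS hrS hbr (by simp [hbX, hrX])) _ _ r _ rfl hG₂
  exact ⟨_, hh₁.glue hrX htX ht hk₁ (fun e => Finset.mem_filter) hF' hh₂⟩

/-- A Steiner `2k`-hyperedge-connected hypergraph has a choice of heads for which every set that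
contains a terminal but not the root is left by at least `k` hyperarcs. -/
theorem exists_heads_of_cut {V E : Type*} [Fintype V] [DecidableEq V] [Fintype E]
    (G : MultiHypergraph V E) (hne : ∀ e, (G.ends e).Nonempty) {T : Finset V} {r : V} (hr : r ∈ T)
    {k : ℕ} (hk : 0 < k)
    (hcut : ∀ X : Finset V, r ∉ X → (∃ t ∈ T, t ∈ X) → 2 * k ≤ G.cutDegree X) :
    ∃ h : E → V, (∀ e, h e ∈ G.ends e) ∧
      ∀ X : Finset V, r ∉ X → (∃ t ∈ T, t ∈ X) → k ≤ G.outDegree h X := by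
  classical
  -- The new root `none` has degree exactly `2k`, and `r` becomes an ordinary terminal. Sets without
  -- `r` do not meet the new edges, so these do not affect the required out-degrees.
  let G' : MultiHypergraph (Option V) (E ⊕ Fin (2 * k)) :=
    ⟨Sum.elim (fun e => (G.ends e).map Function.Embedding.some) fun _ => {none, some r}⟩
  have hl : ∀ e v, v ∈ G'.ends (Sum.inl e) ↔ ∃ w ∈ G.ends e, some w = v := fun e v => by
    simp [G']
  have hrr : ∀ j v, v ∈ G'.ends (Sum.inr j) ↔ v = none ∨ v = some r := fun j v => by
    simp [G']
  let N : Finset (E ⊕ Fin (2 * k)) := Finset.univ.map Function.Embedding.inr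
  have hNcard : N.card = 2 * k := by simp [N]
  have hN : ∀ f, f ∈ N ↔ ∃ j, Sum.inr j = f := by simp [N]
  have hNsub : ∀ X : Finset (Option V), none ∉ X → some r ∈ X → N ⊆ G'.boundary X := by
    intro X h1 h2 f hf
    obtain ⟨j, rfl⟩ := (hN f).1 hf
    exact mem_boundary.2 ⟨⟨some r, by simp [hrr], h2⟩, none, by simp [hrr], h1⟩
  have hbr : G'.boundary {none} = N := by
    ext f
    rw [hN, mem_boundary]
    constructor
    · rintro ⟨⟨a, ha, ha'⟩, -⟩
      rw [Finset.mem_singleton] at ha'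
      subst ha'
      rcases f with e | j
      · simp [hl] at ha
      · exact ⟨j, rfl⟩
    · rintro ⟨j, rfl⟩
      exact ⟨⟨none, by simp [hrr], by simp⟩, some r, by simp [hrr], by simp⟩
  obtain ⟨F, hFN, hF⟩ := Finset.exists_subset_card_eq (s := N) (n := k) (by omega)
  have hinst : G'.IsRootedInstance (insert none (T.map Function.Embedding.some)) none k F := by
    refine ⟨by simp, ⟨some r, by simp [hr], by simp⟩, ?_, ?_, ?_, hbr ▸ hFN, hF⟩
    · rintro (e | j)
      · obtain ⟨w, hw⟩ := hne e
        exact ⟨some w, (hl e _).2 ⟨w, hw, rfl⟩⟩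
      · exact ⟨none, by simp [hrr]⟩
    · rintro X hX ⟨t, ht, htX⟩
      by_cases hrX : some r ∈ X
      · exact hNcard.ge.trans (Finset.card_le_card (hNsub X hX hrX))
      · rw [Finset.mem_insert, Finset.mem_map] at ht
        rcases ht with rfl | ⟨s, hs, rfl⟩
        · exact absurd htX hX
        · refine (hcut (Finset.univ.filter fun v => some v ∈ X) (by simpa using hrX)
            ⟨s, hs, by simpa using htX⟩).trans ?_
          rw [cutDegree, ← Finset.card_map Function.Embedding.inl]
          apply Finset.card_le_card
          intro f hf
          obtain ⟨e, he, rfl⟩ := Finset.mem_map.1 hf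
          obtain ⟨⟨a, ha, haX⟩, b, hb, hbX⟩ := mem_boundary.1 he
          exact mem_boundary.2 ⟨⟨some a, (hl e _).2 ⟨a, ha, rfl⟩, by simpa using haX⟩, some b,
            (hl e _).2 ⟨b, hb, rfl⟩, by simpa using hbX⟩
    · rw [cutDegree, hbr, hNcard]
  obtain ⟨h', hh'⟩ := IsRootedInstance.exists_orientation hk _ G' _ _ F rfl hinst
  have hhead : ∀ e, ∃ w ∈ G.ends e, some w = h' (Sum.inl e) := fun e =>
    (hl e _).1 (hh'.mem (Sum.inl e))
  choose h hh hhs using hhead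
  refine ⟨h, hh, ?_⟩
  rintro X hrX ⟨t, ht, htX⟩
  refine (hh'.out (X.map Function.Embedding.some) (by simp)
    ⟨some t, by simp [ht], by simp [htX]⟩).trans ?_
  rw [outDegree, outDegree, ← Finset.card_map (Function.Embedding.inl : E ↪ E ⊕ Fin (2 * k))]
  apply Finset.card_le_card
  intro f hf
  obtain ⟨⟨a, ha, haX⟩, h1⟩ := mem_outArcs.1 hf
  obtain ⟨a, haX', rfl⟩ := Finset.mem_map.1 haX
  rcases f with e | j
  · refine Finset.mem_map.2 ⟨e, mem_outArcs.2 ⟨⟨a, ?_, haX'⟩, ?_⟩, rfl⟩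
    · obtain ⟨w, hw, hwa⟩ := (hl e _).1 ha
      simp only [Function.Embedding.some_apply, Option.some.injEq] at hwa
      exact hwa ▸ hw
    · rw [← hhs e] at h1
      simpa using h1
  · rw [hrr] at ha
    simp only [Function.Embedding.some_apply, reduceCtorEq, Option.some.injEq, false_or] at ha
    exact absurd (ha ▸ haX') hrX

/-! ### Menger's theorem and directed paths -/

section Menger

variable {V E : Type*} [Fintype V] [DecidableEq V] [Fintype E] [DecidableEq E]

/-- Menger's theorem for hyperarcs, with several sources: if every set that avoids `r` is left by at
least as many hyperarcs of `A` as it contains sources, then all sources are linked to `r` by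
disjoint sets of hyperarcs. -/
lemma exists_disjoint_reaching_sets {ι : Type*} [Fintype ι] [DecidableEq ι]
    (G : MultiHypergraph V E) (h : E → V) (hh : ∀ e, h e ∈ G.ends e) (r : V) (n : ℕ) :
    ∀ (A : Finset E) (p : ι → V), A.card = n →
      (∀ X : Finset V, r ∉ X →
        (Finset.univ.filter fun i => p i ∈ X).card ≤ (G.outArcs h X ∩ A).card) →
      ∃ B : ι → Finset E, (∀ i, B i ⊆ A) ∧ (Pairwise fun i j => Disjoint (B i) (B j)) ∧
        ∀ i, Relation.ReflTransGen
          (fun a b => ∃ e ∈ B i, a ∈ (G.ends e).erase (h e) ∧ h e = b) (p i) r := by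
  induction n using Nat.strong_induction_on with
  | _ n ih =>
  rintro A p rfl hA
  by_cases hp : ∀ i, p i = r
  · refine ⟨fun _ => ∅, fun _ => Finset.empty_subset _, fun _ _ _ => Finset.disjoint_empty_left _,
      fun i => ?_⟩
    rw [hp i]
  push Not at hp
  obtain ⟨i₀, hi₀⟩ := hp
  set tok : Finset V → Finset ι := fun X => Finset.univ.filter fun i => p i ∈ X with htok
  have hmem : ∀ X i, i ∈ tok X ↔ p i ∈ X := fun X i => by simp [htok]
  -- `M` is a largest set without slack that avoids `r` and the token at `p i₀`. Adding `p i₀` adds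
  -- a token, so some hyperarc `e` leaves the larger set but not `M`; then `e` is disjoint from `M`
  -- and has tail `p i₀`. The token moves along `e`, and `e` is deleted.
  obtain ⟨M, hM, hmax⟩ := Finset.exists_max_image (Finset.univ.filter fun M : Finset V =>
    r ∉ M ∧ p i₀ ∉ M ∧ (G.outArcs h M ∩ A).card ≤ (tok M).card) Finset.card
    ⟨∅, Finset.mem_filter.2 ⟨Finset.mem_univ _, Finset.notMem_empty _, Finset.notMem_empty _, by
      simp [outArcs]⟩⟩
  simp only [Finset.mem_filter, Finset.mem_univ, true_and] at hM hmax
  obtain ⟨hrM, hvM, hMt⟩ := hM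
  obtain ⟨e, he, heM⟩ : ∃ e ∈ G.outArcs h (insert (p i₀) M) ∩ A, e ∉ G.outArcs h M ∩ A := by
    by_contra! hcon
    have h1 := Finset.card_le_card hcon
    have h2 := hA (insert (p i₀) M) (by simp [hrM, hi₀.symm])
    have h3 : tok M ⊂ tok (insert (p i₀) M) := by
      rw [Finset.ssubset_iff_of_subset]
      · exact ⟨i₀, by simp [hmem], by simpa [hmem] using hvM⟩
      · intro i
        simp only [hmem, Finset.mem_insert]
        exact Or.inr
    have h4 := Finset.card_lt_card h3
    change (tok (insert (p i₀) M)).card ≤ _ at h2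
    omega
  rw [Finset.mem_inter, mem_outArcs, Finset.mem_insert, not_or] at he
  obtain ⟨⟨⟨w, hw, hwM⟩, hhv, hhM⟩, heA⟩ := he
  have hdisj : ∀ z ∈ G.ends e, z ∉ M := fun z hz hzM =>
    heM (Finset.mem_inter.2 ⟨mem_outArcs.2 ⟨⟨z, hz, hzM⟩, hhM⟩, heA⟩)
  have hve : p i₀ ∈ G.ends e := by
    rcases Finset.mem_insert.1 hwM with h1 | h1
    · exact h1 ▸ hw
    · exact absurd h1 (hdisj w hw)
  -- Only sets that meet `e` and miss `p i₀` are endangered by the move. Without slack, the union of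
  -- such a set with `M` would have none either, against the maximality of `M`.
  have hstrict : ∀ X : Finset V, r ∉ X → p i₀ ∉ X → (∃ z ∈ G.ends e, z ∈ X) →
      (tok X).card + 1 ≤ (G.outArcs h X ∩ A).card := by
    rintro X hrX hvX ⟨z, hz, hzX⟩
    by_contra hcon
    have h1 := G.card_outArcs_inter_submodular h A X M
    have h2 : (tok (X ∩ M)).card + (tok (X ∪ M)).card = (tok X).card + (tok M).card := by
      rw [← Finset.card_union_add_card_inter (tok X), add_comm]
      congr 2
      · ext i
        simp [hmem]
      · ext i
        simp [hmem]
    have h3 : (tok (X ∩ M)).card ≤ _ := hA (X ∩ M) (by simp [hrX])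
    have h4 := hmax (X ∪ M) ⟨by simp [hrX, hrM], by simp [hvX, hvM], by omega⟩
    have h5 := Finset.eq_of_subset_of_card_le Finset.subset_union_right h4
    exact hdisj z hz (h5 ▸ Finset.mem_union_left _ hzX)
  set q : ι → V := Function.update p i₀ (h e) with hq
  have hq₀ : q i₀ = h e := by simp [hq]
  have hq' : ∀ i, i ≠ i₀ → q i = p i := fun i hi => by simp [hq, hi]
  have hlt : (A.erase e).card < A.card := Finset.card_erase_lt_of_mem heA
  obtain ⟨B, hBA, hB, hBr⟩ := ih _ hlt (A.erase e) q rfl (by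
    intro X hrX
    have h1 : (tok X).card ≤ _ := hA X hrX
    have hout : e ∉ G.outArcs h X → G.outArcs h X ∩ A.erase e = G.outArcs h X ∩ A := by
      intro h2
      ext f
      simp only [Finset.mem_inter, Finset.mem_erase]
      refine and_congr_right fun hf => ⟨fun h3 => h3.2, fun h3 => ⟨?_, h3⟩⟩
      rintro rfl
      exact h2 hf
    have hout' : (G.outArcs h X ∩ A).card ≤ (G.outArcs h X ∩ A.erase e).card + 1 := by
      rw [Finset.inter_erase]
      have := Finset.pred_card_le_card_erase (s := G.outArcs h X ∩ A) (a := e)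
      omega
    have hins : (Finset.univ.filter fun i => q i ∈ X) ⊆ insert i₀ ((tok X).erase i₀) := by
      intro i hi
      by_cases h2 : i = i₀
      · simp [h2]
      · simp only [Finset.mem_filter, Finset.mem_univ, true_and, hq' i h2] at hi
        simp [h2, hmem, hi]
    have hins' : h e ∉ X → (Finset.univ.filter fun i => q i ∈ X) ⊆ (tok X).erase i₀ := by
      intro h2 i hi
      by_cases h3 : i = i₀
      · subst h3
        simp [hq₀, h2] at hi
      · simpa [h3] using hins hi
    have hc := (Finset.card_le_card hins).trans (Finset.card_insert_le _ _)
    by_cases hvX : p i₀ ∈ X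
    · have h2 := Finset.card_erase_of_mem ((hmem X i₀).2 hvX)
      have h3 : 0 < (tok X).card := Finset.card_pos.2 ⟨i₀, (hmem X i₀).2 hvX⟩
      by_cases hhX : h e ∈ X
      · rw [hout fun h0 => (mem_outArcs.1 h0).2 hhX]
        omega
      · have h4 := Finset.card_le_card (hins' hhX)
        omega
    · have h2 := Finset.card_erase_le (s := tok X) (a := i₀)
      by_cases hm : ∃ z ∈ G.ends e, z ∈ X
      · have h3 := hstrict X hrX hvX hm
        by_cases hhX : h e ∈ X
        · rw [hout fun h0 => (mem_outArcs.1 h0).2 hhX]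
          omega
        · have h4 := Finset.card_le_card (hins' hhX)
          omega
      · rw [hout fun h0 => hm (mem_outArcs.1 h0).1]
        have h4 := Finset.card_le_card (hins' fun h0 => hm ⟨h e, hh e, h0⟩)
        omega)
  refine ⟨Function.update B i₀ (insert e (B i₀)), ?_, ?_, ?_⟩
  · intro i
    by_cases hi : i = i₀
    · subst hi
      rw [Function.update_self]
      exact Finset.insert_subset heA ((hBA i).trans (Finset.erase_subset _ _))
    · rw [Function.update_of_ne hi]
      exact (hBA i).trans (Finset.erase_subset _ _)
  · have hnot : ∀ i, e ∉ B i := fun i h0 => (Finset.mem_erase.1 (hBA i h0)).1 rfl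
    intro i j hij
    by_cases hi : i = i₀
    · subst hi
      rw [Function.update_self, Function.update_of_ne hij.symm, Finset.disjoint_insert_left]
      exact ⟨hnot j, hB hij⟩
    · by_cases hj : j = i₀
      · subst hj
        rw [Function.update_self, Function.update_of_ne hij, Finset.disjoint_insert_right]
        exact ⟨hnot i, hB hij⟩
      · rw [Function.update_of_ne hi, Function.update_of_ne hj]
        exact hB hij
  · intro i
    by_cases hi : i = i₀
    · subst hi
      rw [Function.update_self]
      refine Relation.ReflTransGen.head (b := h e)
        ⟨e, Finset.mem_insert_self _ _, Finset.mem_erase.2 ⟨fun h0 => hhv h0.symm, hve⟩, rfl⟩ ?_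
      have := hBr i
      rw [hq₀] at this
      exact Relation.ReflTransGen.mono (fun a b ⟨f, hf, h1⟩ => ⟨f, Finset.mem_insert_of_mem hf, h1⟩)
        _ _ this
    · rw [Function.update_of_ne hi, ← hq' i hi]
      exact hBr i

end Menger

/-- Reachability inside a set `B` of hyperarcs gives a directed path with hyperarcs in `B`. -/
lemma Orientation.exists_directedPath {V E : Type*} [DecidableEq V] {G : MultiHypergraph V E}
    (D : G.Orientation) (B : Finset E) {u v : V}
    (huv : Relation.ReflTransGen (fun a b => ∃ e ∈ B, a ∈ D.tails e ∧ D.head e = b) u v) :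
    ∃ P : D.DirectedPath u v, ∀ i, P.arc i ∈ B := by
  classical
  by_cases huv' : u = v
  · subst huv'
    exact ⟨⟨0, fun _ => u, Fin.elim0, fun i j _ => Subsingleton.elim (α := Fin 1) i j,
      fun i => i.elim0, rfl, rfl, fun i => i.elim0, fun i => i.elim0⟩, fun i => i.elim0⟩
  have hex : ∃ (n : ℕ) (f : ℕ → V) (g : ℕ → E), f 0 = u ∧ f n = v ∧
      ∀ i < n, f i ∈ D.tails (g i) ∧ D.head (g i) = f (i + 1) ∧ g i ∈ B := by
    have : Nonempty E := by
      rcases Relation.ReflTransGen.cases_head huv with h | ⟨c, ⟨e, -⟩, -⟩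
      · exact absurd h huv'
      · exact ⟨e⟩
    clear huv'
    induction huv using Relation.ReflTransGen.head_induction_on with
    | refl => exact ⟨0, fun _ => v, fun _ => Classical.arbitrary E, rfl, rfl, by simp⟩
    | @head a c hab _ ih =>
      obtain ⟨e, heB, he, rfl⟩ := hab
      obtain ⟨n, f, g, hf0, hfn, hfg⟩ := ih
      refine ⟨n + 1, fun i => Nat.casesOn i a f, fun i => Nat.casesOn i e g, rfl, hfn, ?_⟩
      rintro (_ | i) hi
      · exact ⟨he, hf0.symm, heB⟩
      · exact hfg i (by omega)
  obtain ⟨f, g, hf0, hfn, hfg⟩ := Nat.find_spec hex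
  set n := Nat.find hex with hn
  -- In a shortest walk a repeated vertex is impossible, as the closed part between `i` and `j`
  -- could be cut out.
  have hinj : ∀ i j, i < j → j ≤ n → f i ≠ f j := by
    intro i j hij hjn hfij
    refine Nat.find_min hex (m := n - (j - i)) (by omega)
      ⟨fun l => if l ≤ i then f l else f (l + (j - i)),
        fun l => if l < i then g l else g (l + (j - i)), by simp [hf0], ?_, ?_⟩
    · by_cases h1 : n - (j - i) ≤ i
      · have h2 : j = n := by omega
        have h3 : n - (j - i) = i := by omega
        simp only [h3, le_refl, if_true]
        rw [hfij, h2, hfn]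
      · simp only [h1, if_false]
        rw [← hfn]
        congr 1
        omega
    · intro l hl
      rcases lt_trichotomy l i with h1 | h1 | h1
      · simp only [h1.le, h1, if_true, Nat.succ_le_of_lt h1]
        exact hfg l (by omega)
      · subst h1
        have h2 : l + (j - l) = j := by omega
        have h3 : l + 1 + (j - l) = j + 1 := by omega
        simp only [le_refl, lt_irrefl, if_true, if_false, h2, h3, Nat.not_succ_le_self, hfij]
        exact hfg j (by omega)
      · have h2 : ¬ l ≤ i := by omega
        have h3 : ¬ l < i := by omega
        have h4 : ¬ l + 1 ≤ i := by omega
        simp only [h2, h3, h4, if_false]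
        have h5 : l + 1 + (j - i) = l + (j - i) + 1 := by omega
        rw [h5]
        exact hfg _ (by omega)
  have hinj' : ∀ i j, i ≤ n → j ≤ n → f i = f j → i = j := by
    intro i j hi hj hf
    rcases lt_trichotomy i j with h1 | h1 | h1
    · exact absurd hf (hinj i j h1 hj)
    · exact h1
    · exact absurd hf.symm (hinj j i h1 hi)
  refine ⟨⟨n, fun i => f i, fun i => g i, ?_, ?_, hf0, hfn, fun i => (hfg i i.2).1,
    fun i => (hfg i i.2).2.1⟩, fun i => (hfg i i.2).2.2⟩
  · intro i j hij
    exact Fin.ext (hinj' i j (by omega) (by omega) hij)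
  · intro i j hij
    -- Equal hyperarcs have equal heads, and the heads are distinct vertices of the walk.
    have h1 := (hfg i i.2).2.1
    have h2 := (hfg j j.2).2.1
    simp only at hij
    rw [hij, h2] at h1
    have := hinj' _ _ (by omega) (by omega) h1
    exact Fin.ext (by omega)

/-- All `k` tokens of the Menger argument start at `t`, so only sets containing `t` impose a
condition. -/
lemma Orientation.hasHyperarcDisjointPaths {V E : Type*} [Fintype V] [DecidableEq V] [Fintype E]
    {G : MultiHypergraph V E} (D : G.Orientation) {k : ℕ} {t r : V}
    (hout : ∀ X : Finset V, r ∉ X → t ∈ X → k ≤ G.outDegree D.head X) :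
    D.HasHyperarcDisjointPaths k t r := by
  classical
  obtain ⟨B, -, hB, hBr⟩ := exists_disjoint_reaching_sets (ι := Fin k) G D.head D.head_mem r _
    Finset.univ (fun _ => t) rfl (by
      intro X hrX
      rw [Finset.inter_univ]
      by_cases htX : t ∈ X
      · simpa [htX, outDegree] using hout X hrX htX
      · simp [htX])
  choose P hP using fun i => D.exists_directedPath (B i) (hBr i)
  refine ⟨P, fun i j hij => ?_⟩
  refine Set.disjoint_left.2 ?_
  rintro _ ⟨a, rfl⟩ ⟨b, hb⟩
  exact Finset.disjoint_left.1 (hB hij) (hP i a) (hb ▸ hP j b)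

end MultiHypergraph

theorem mainTheorem5 {V E : Type*} [Fintype V] [DecidableEq V] [Fintype E]
    (G : MultiHypergraph V E) (hne : ∀ e, (G.ends e).Nonempty)
    (T : Finset V) (r : V) (hr : r ∈ T) (k : ℕ) (hk : 0 < k)
    (hconn : G.SteinerHyperedgeConnected T (2 * k)) :
    ∃ D : G.Orientation, D.SteinerRootedHyperarcConnected T r k := by
  obtain ⟨h, hh, hout⟩ := G.exists_heads_of_cut hne hr hk (by
    rintro X hrX ⟨t, ht, htX⟩
    exact (hconn t ht r hr fun h0 => hrX (h0 ▸ htX)).trans (Nat.sInf_le ⟨X, htX, hrX, rfl⟩))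
  exact ⟨⟨h, hh⟩, fun t ht _ =>
    MultiHypergraph.Orientation.hasHyperarcDisjointPaths _ fun X hrX htX => hout X hrX ⟨t, ht, htX⟩⟩
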